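/- Let $X=(X,d,\mu)$ be a complete unbounded metric space equipped with a Borel measure $\mu$ such that every closed ball $B(x,r)=\{y: d(x,y)\le r\}$, $r>0$, satisfies $0<\mu(B(x,r))<\infty$, and $\mu$ is doubling, i.e. $\mu(B(x,2r))\le C\mu(B(x,r))$ for all $x\in X$, $r>0$. A Borel function $g\colon X\to[0,\infty]$ is an upper gradient of $f\colon X\to\mathbb R$ if $|f(y)-f(x)|\le\int_\gamma g\,ds$ for every compact rectifiable curve $\gamma$ in $X$ with endpoints $x,y$. For $1\le q<\infty$, $X$ supports a $q$-Poincaré inequality if there are $C>0$ and $\lambda\ge1$ such that $$\frac1{\mu(B)}\int_B|f-f_B|\,d\mu\le C\,r\Bigl(\frac1{\mu(\lambda B)}\int_{\lambda B}g^q\,d\mu\Bigr)^{1/q},\qquad f_B=\frac1{\mu(B)}\int_B f\,d\mu,$$ for all balls $B=B(x,r)$, $\lambda B=B(x,\lambda r)$, all $f$ integrable on balls and all upper gradients $g$ of $f$. For $E\subset X$ let $E_r=\{x:\operatorname{dist}(x,E)<r\}$, and let the lower Assouad codimension $\underline{\operatorname{co\,dim}}_A(E)\in[0,\infty]$ be the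 supremum of all $t\ge0$ for which there is $C\ge1$ such that $$\frac{\mu(E_r\cap B(x,R))}{\mu(B(x,R))}\le C\Bigl(\frac rR\Bigr)^t\qquad\text{for all }x\in E\text{ and all }0<r<R<\infty.$$ **Theorem.** Let $1\le p<\infty$ and $\beta<p-1$. If $\beta\le0$, assume that $X$ supports a $p$-Poincaré inequality, and if $\beta>0$, assume that $X$ supports a $(p-\beta)$-Poincaré inequality. If $\Omega\subset X$ is an open set with $\underline{\operatorname{co\,dim}}_A(X\setminus\Omega)>p-\beta$, then $\Omega$ admits a $(p,\beta)$-Hardy inequality: there is a constant $C>0$ such that $$\int_\Omega|u(x)|^p\,d_\Omega(x)^{\beta-p}\,d\mu\le C\int_\Omega g(x)^p\,d_\Omega(x)^{\beta}\,d\mu$$ for all Lipschitz functions $u$ with compact support contained in $\Omega$ (extended by zero to $X$) and all upper gradients $g$ of $u$, where $d_\Omega(x)=\operatorname{dist}(x,X\setminus\Omega)$ (with $\operatorname{dist}(x,\emptyset)=\infty$). -/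

import Mathlib

open MeasureTheory Metric Set
open scoped NNReal ENNReal

namespace HardyAssouad

/-- The standing conventions on a metric measure space: closed balls of positive radius
have positive and finite measure, and the measure is doubling. -/
structure IsDoubling {X : Type*} [MetricSpace X] [MeasurableSpace X] (μ : Measure X) : Prop where
  ball_pos : ∀ (x : X) (r : ℝ), 0 < r → 0 < μ (closedBall x r)
  ball_lt_top : ∀ (x : X) (r : ℝ), 0 < r → μ (closedBall x r) < ∞
  doubling : ∃ C : ℝ≥0, ∀ (x : X) (r : ℝ), 0 < r →
    μ (closedBall x (2 * r)) ≤ C * μ (closedBall x r)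

/-- `γ`, restricted to `[0, L]`, is a compact rectifiable curve of length `L`, parametrized by
arc length (the length of `γ` on each `[s, t] ⊆ [0, L]` is `t - s`). Every compact rectifiable
curve has such a parametrization, and line integrals along it are defined by it. -/
def IsArcLengthCurve {X : Type*} [MetricSpace X] (γ : ℝ → X) (L : ℝ) : Prop :=
  0 ≤ L ∧ HasUnitSpeedOn γ (Icc 0 L)

/-- The line integral `∫_γ g ds` along a curve parametrized by arc length on `[0, L]`. -/
noncomputable def lineIntegral {X : Type*} (g : X → ℝ≥0∞) (γ : ℝ → X) (L : ℝ) : ℝ≥0∞ :=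
  ∫⁻ t in Icc 0 L, g (γ t)

/-- The Borel function `g : X → [0, ∞]` is an upper gradient of `f : X → ℝ`: for every compact
rectifiable curve with endpoints `x`, `y` one has `|f y - f x| ≤ ∫_γ g ds`. -/
structure IsUpperGradient {X : Type*} [MetricSpace X] [MeasurableSpace X]
    (f : X → ℝ) (g : X → ℝ≥0∞) : Prop where
  measurable : Measurable g
  le_lineIntegral : ∀ (γ : ℝ → X) (L : ℝ), IsArcLengthCurve γ L →
    ENNReal.ofReal |f (γ L) - f (γ 0)| ≤ lineIntegral g γ L

/-- `X` supports a `(1, p)`-Poincaré inequality: there are `C` and `lam ≥ 1` such that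
`⨍_B |f - f_B| dμ ≤ C r (⨍_{lam B} g ^ p dμ) ^ (1 / p)` for each ball `B = B(x, r)`, each `f`
that is integrable on balls (so that `f_B` makes sense) and each upper gradient `g` of `f`. -/
def SupportsPoincare {X : Type*} [MetricSpace X] [MeasurableSpace X]
    (μ : Measure X) (p : ℝ) : Prop :=
  ∃ (C : ℝ≥0) (lam : ℝ), 1 ≤ lam ∧
    ∀ (f : X → ℝ) (g : X → ℝ≥0∞),
      (∀ (y : X) (s : ℝ), IntegrableOn f (closedBall y s) μ) → IsUpperGradient f g →
      ∀ (x : X) (r : ℝ), 0 < r →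
        (⨍⁻ y in closedBall x r, ‖f y - ⨍ z in closedBall x r, f z ∂μ‖ₑ ∂μ)
          ≤ C * ENNReal.ofReal r *
            (⨍⁻ y in closedBall x (lam * r), g y ^ p ∂μ) ^ (1 / p)

/-- The lower Assouad codimension of a subset `E` of an unbounded space `X`: the supremum of all
`t ≥ 0` such that for some `C ≥ 1`,
`μ (E_r ∩ B(x, R)) / μ (B(x, R)) ≤ C (r / R) ^ t` for all `x ∈ E` and all `0 < r < R`, where
`E_r` is the open `r`-neighbourhood of `E`. For unbounded `E` the restriction `R < diam E` is
empty; for bounded `E` (in particular, for a single point) all scales `0 < r < R < ∞` of the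
unbounded space are taken into account. -/
noncomputable def lowerAssouadCodim {X : Type*} [MetricSpace X] [MeasurableSpace X]
    (μ : Measure X) (E : Set X) : ℝ≥0∞ :=
  ⨆ (t : ℝ≥0) (_ : ∃ C : ℝ, 1 ≤ C ∧ ∀ x ∈ E, ∀ r R : ℝ, 0 < r → r < R →
      μ (thickening r E ∩ closedBall x R) / μ (closedBall x R)
        ≤ ENNReal.ofReal (C * (r / R) ^ (t : ℝ))),
    (t : ℝ≥0∞)

/-- `Ω` admits a `(p, β)`-Hardy inequality: for some constant `C > 0`,
`∫_Ω |u| ^ p d_Ω ^ (β - p) dμ ≤ C ∫_Ω g ^ p d_Ω ^ β dμ` for all Lipschitz functions `u` whose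
support is a compact subset of `Ω` (extended by zero to `X`) and all upper gradients `g` of `u`;
here `d_Ω x` is the distance from `x` to the complement of `Ω`. -/
def AdmitsHardy {X : Type*} [MetricSpace X] [MeasurableSpace X]
    (μ : Measure X) (Ω : Set X) (p β : ℝ) : Prop :=
  ∃ C : ℝ≥0, 0 < C ∧
    ∀ (u : X → ℝ) (g : X → ℝ≥0∞),
      (∃ K : ℝ≥0, LipschitzWith K u) → HasCompactSupport u → tsupport u ⊆ Ω →
      IsUpperGradient u g →
      ∫⁻ x in Ω, ‖u x‖ₑ ^ p * infEDist x Ωᶜ ^ (β - p) ∂μ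
        ≤ C * ∫⁻ x in Ω, g x ^ p * infEDist x Ωᶜ ^ β ∂μ

end HardyAssouad

/-! Write `E` for the complement of `Ω` and `d` for the distance to `E`. The core is
`exists_weighted_hardy_of_isThin`, which works directly with sums over scales. Unbounded doubling
spaces have infinite mass, so the averages of a compactly supported `f` over `B(x, 2^i)` tend to `0`
as `i → ∞` and to `f x` as `i → -∞`. Telescoping with the Poincaré inequality gives `|f x| ≤ C ∑ᵢ
2^i (⨍ G^q)^(1/q)`, the averages being over `B(x, lam 2^i)`, `i ∈ ℤ`
(`exists_enorm_le_tsum_laverage`).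

For `x` in the shell `d ≈ 2^j`, take the `p`-th power with weights decaying in `|i - j|`, and
replace `(⨍ G^q)^(p/q)` by `R^(-δ) ⨍ G^p d^δ`. Integrating over the shell and applying Fubini puts
on `G^p d^δ` at `y` the proportion of `B(y, lam 2^i)` filled by the shell. The codimension bound
makes this at most a constant times `2^(-t max(i - j, 0))`, and it vanishes unless `d y ≲
2^max(i,j)`. For `δ < p` and `t > p - δ + η` the exponents leave `2^(-σ|i-j|) 2^(-η max(i,j))`, and
the sum over `i, j` is at most a constant times `d(y)^(-η)`. This is the Hardy inequality with `β =
δ - η`, where `η > 0` is essential for the geometric series.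

If `β < 0`, take `δ = 0`, `η = -β`, `q = p`. If `β > 0`, take `q = p - β` and `δ` slightly above
`β`; the passage from `G^q` to `G^p d^δ` is Hölder's inequality together with local integrability of
negative powers of `d` (`IsThin.exists_rpow_setLAverage_le`). If `β = 0`, then `p > 1`, and the case
of small `η` is applied to `u d^(η/p)`. The product rule adds a term `(η/p)|u| d^(η/p - 1)`, which
enters with a constant of order `η^p / η = η^(p-1)`, small enough to be absorbed into the left side.
-/

namespace HardyAssouad

/-! ### Consequences of doubling: finiteness, separability, infinite total mass. -/

section Doubling

variable {X : Type*} [MetricSpace X] [MeasurableSpace X] {μ : Measure X}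

theorem IsDoubling.exists_measure_closedBall_mul_le (hμ : IsDoubling μ) (Λ : ℝ) :
    ∃ C : ℝ≥0, ∀ (x : X) (r : ℝ), 0 < r →
      μ (closedBall x (Λ * r)) ≤ C * μ (closedBall x r) := by
  obtain ⟨C, hC⟩ := hμ.doubling
  have key : ∀ (n : ℕ) (x : X) (r : ℝ), 0 < r →
      μ (closedBall x (2 ^ n * r)) ≤ (C : ℝ≥0∞) ^ n * μ (closedBall x r) := by
    intro n x r hr
    induction n with
    | zero => simp
    | succ n ih =>
      calc μ (closedBall x (2 ^ (n + 1) * r)) = μ (closedBall x (2 * (2 ^ n * r))) := by ring_nf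
        _ ≤ C * μ (closedBall x (2 ^ n * r)) := hC _ _ (by positivity)
        _ ≤ C * ((C : ℝ≥0∞) ^ n * μ (closedBall x r)) := by gcongr
        _ = _ := by ring
  obtain ⟨n, hn⟩ := pow_unbounded_of_one_lt Λ (one_lt_two (α := ℝ))
  refine ⟨C ^ n, fun x r hr => ?_⟩
  push_cast
  exact (measure_mono (closedBall_subset_closedBall (by gcongr))).trans (key n x r hr)

theorem IsDoubling.exists_measure_closedBall_le_of_dist_le (hμ : IsDoubling μ) :
    ∃ C : ℝ≥0, ∀ (x y : X) (r : ℝ), 0 < r → dist x y ≤ r →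
      μ (closedBall x r) ≤ C * μ (closedBall y r) := by
  obtain ⟨C, hC⟩ := hμ.doubling
  refine ⟨C, fun x y r hr hxy => ?_⟩
  exact (measure_mono (closedBall_subset_closedBall' (by linarith))).trans (hC y r hr)

theorem IsDoubling.measure_closedBall_ne_zero (hμ : IsDoubling μ) (x : X) {r : ℝ} (hr : 0 < r) :
    μ (closedBall x r) ≠ 0 := (hμ.ball_pos x r hr).ne'

theorem IsDoubling.measure_closedBall_ne_top (hμ : IsDoubling μ) (x : X) (r : ℝ) :
    μ (closedBall x r) ≠ ∞ :=
  ((measure_mono (closedBall_subset_closedBall (le_max_left r 1))).trans_lt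
    (hμ.ball_lt_top x _ (lt_max_of_lt_right one_pos))).ne

theorem IsDoubling.isFiniteMeasureOnCompacts (hμ : IsDoubling μ) :
    IsFiniteMeasureOnCompacts μ := by
  refine ⟨fun K hK => ?_⟩
  rcases K.eq_empty_or_nonempty with rfl | ⟨x, -⟩
  · simp
  · obtain ⟨R, hR⟩ := hK.isBounded.subset_closedBall x
    exact (measure_mono hR).trans_lt (hμ.measure_closedBall_ne_top x R).lt_top

theorem IsDoubling.sigmaFinite (hμ : IsDoubling μ) : SigmaFinite μ := by
  rcases isEmpty_or_nonempty X with h | ⟨⟨x⟩⟩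
  · have : μ = 0 := Measure.eq_zero_of_isEmpty μ
    rw [this]; infer_instance
  · refine ⟨⟨⟨fun n => closedBall x n, fun _ => trivial, fun n =>
      (hμ.measure_closedBall_ne_top x n).lt_top, iUnion_closedBall_nat x⟩⟩⟩

/-- A maximal `ε`-separated set is the centre set of disjoint balls of positive measure, hence
countable by σ-finiteness. Separability makes `dist` measurable on the product, as Fubini requires
below. -/
theorem IsDoubling.secondCountableTopology [BorelSpace X] (hμ : IsDoubling μ) :
    SecondCountableTopology X := by
  have := hμ.sigmaFinite
  refine Metric.secondCountable_of_almost_dense_set fun ε hε => ?_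
  obtain ⟨s, hs⟩ := zorn_subset {s : Set X | s.Pairwise fun x y => ε < dist x y} (by
    intro c hc hchain
    refine ⟨⋃₀ c, ?_, fun s hs => subset_sUnion_of_mem hs⟩
    exact (pairwise_sUnion hchain.directedOn).2 fun s hs => hc hs)
  refine ⟨s, ?_, fun x => ?_⟩
  · have := Measure.countable_meas_pos_of_disjoint_iUnion (μ := μ)
      (As := fun x : s => closedBall (x : X) (ε / 2)) (fun _ => measurableSet_closedBall) (by
        intro x y hxy
        refine closedBall_disjoint_closedBall ?_
        have := hs.prop x.2 y.2 (fun h => hxy (Subtype.ext h))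
        linarith)
    have h2 : {i : s | 0 < μ (closedBall (i : X) (ε / 2))} = univ :=
      eq_univ_of_forall fun i => hμ.ball_pos _ _ (half_pos hε)
    rw [h2] at this
    exact countable_coe_iff.1 (countable_univ_iff.1 this)
  · by_contra! h
    have hx : insert x s ∈ {s : Set X | s.Pairwise fun x y => ε < dist x y} := by
      refine Set.Pairwise.insert hs.prop fun y hy _ => ⟨h y hy, ?_⟩
      rw [dist_comm]; exact h y hy
    have := h x (hs.le_of_ge hx (subset_insert x s) (mem_insert x s))
    rw [dist_self] at this
    exact this.not_gt hε

/-- If the total mass were finite, doubling around a far point would bound the mass of each `B(x,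
n)` by a multiple of the mass outside it, which tends to `0`. -/
theorem IsDoubling.tendsto_measure_closedBall [BorelSpace X] (hμ : IsDoubling μ)
    (hX : ¬ Bornology.IsBounded (univ : Set X)) (x : X) :
    Filter.Tendsto (fun n : ℕ => μ (closedBall x n)) Filter.atTop (nhds ∞) := by
  have hlim : Filter.Tendsto (fun n : ℕ => μ (closedBall x n)) Filter.atTop (nhds (μ univ)) := by
    rw [← iUnion_closedBall_nat x]
    exact tendsto_measure_iUnion_atTop
      (fun m n h => closedBall_subset_closedBall (by exact_mod_cast h))
  suffices h : μ univ = ∞ by rwa [h] at hlim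
  by_contra hfin
  obtain ⟨C, hC⟩ := hμ.exists_measure_closedBall_mul_le 4
  have key : ∀ n : ℕ, 0 < n →
      μ (closedBall x n) ≤ C * (μ univ - μ (closedBall x n)) := by
    intro n hn
    have hn' : (0 : ℝ) < n := by exact_mod_cast hn
    -- With `D = dist y x > 3n`, the ball `B(y, D/2)` misses `B(x, n)` while `B(y, 2D)` contains it.
    obtain ⟨y, hy⟩ : ∃ y, 3 * (n : ℝ) < dist y x := by
      by_contra! h
      exact hX (isBounded_closedBall.subset fun y _ => mem_closedBall.2 (h y))
    set D := dist y x
    calc μ (closedBall x n) ≤ μ (closedBall y (4 * (D / 2))) :=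
          measure_mono (closedBall_subset_closedBall' (by rw [dist_comm x y]; linarith))
      _ ≤ C * μ (closedBall y (D / 2)) := hC _ _ (by linarith)
      _ ≤ C * μ (closedBall x n)ᶜ := by
          gcongr
          exact (closedBall_disjoint_closedBall (by linarith)).subset_compl_right
      _ = _ := by
          rw [measure_compl measurableSet_closedBall (hμ.measure_closedBall_ne_top x n)]
  have hlim2 : Filter.Tendsto (fun n : ℕ => C * (μ univ - μ (closedBall x n))) Filter.atTop
      (nhds (C * (μ univ - μ univ))) :=
    ENNReal.Tendsto.const_mul (ENNReal.Tendsto.sub tendsto_const_nhds hlim (Or.inl hfin))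
      (Or.inr ENNReal.coe_ne_top)
  have := le_of_tendsto_of_tendsto hlim hlim2 (Filter.eventually_atTop.2 ⟨1, fun n hn => key n hn⟩)
  have h0 : μ univ ≤ 0 := by simpa using this
  exact hμ.measure_closedBall_ne_zero x one_pos
    (le_antisymm ((measure_mono (subset_univ _)).trans h0) bot_le)

end Doubling

theorem ennreal_rpow_le_rpow_of_nonpos {a b : ℝ≥0∞} (h : a ≤ b) {s : ℝ} (hs : s ≤ 0) :
    b ^ s ≤ a ^ s := by
  rw [← neg_neg s, ENNReal.rpow_neg, ENNReal.rpow_neg a]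
  exact ENNReal.inv_le_inv.2 (ENNReal.rpow_le_rpow h (by linarith))

/-! ### Thin sets: integrability of negative powers of the distance, and the averaging kernel. -/

section Thin

variable {X : Type*} [MetricSpace X] [MeasurableSpace X] {μ : Measure X}

/-- The `r`-neighbourhood of `E` occupies at most the proportion `A (r / R) ^ t` of every ball of
radius `R`. -/
def IsThin (μ : Measure X) (E : Set X) (t : ℝ) (A : ℝ≥0) : Prop :=
  ∀ (y : X) (R r : ℝ), 0 < R → 0 < r →
    μ ({x | infEDist x E < ENNReal.ofReal r} ∩ closedBall y R)
      ≤ A * ENNReal.ofReal ((r / R) ^ t) * μ (closedBall y R)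

/-- Frees the codimension bound of its restrictions: centres need not lie in `E`, since a ball that
meets the neighbourhood lies in a comparable ball centred on `E`; for `r ≥ R` the bound is trivial.
-/
theorem exists_isThin (hμ : IsDoubling μ) {E : Set X} {t C : ℝ} (ht : 0 ≤ t)
    (h : ∀ x ∈ E, ∀ r R : ℝ, 0 < r → r < R →
      μ (thickening r E ∩ closedBall x R) / μ (closedBall x R)
        ≤ ENNReal.ofReal (C * (r / R) ^ t)) :
    ∃ A : ℝ≥0, IsThin μ E t A := by
  -- For `z ∈ E` with `dist y z ≤ 2R` one has `B(y, R) ⊆ B(z, 3R) ⊆ B(y, 6R)`.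
  obtain ⟨M, hM⟩ := hμ.exists_measure_closedBall_mul_le 6
  refine ⟨max 1 (Real.toNNReal C * M), fun y R r hR hr => ?_⟩
  rcases le_or_gt R r with hRr | hrR
  · calc μ ({x | infEDist x E < ENNReal.ofReal r} ∩ closedBall y R)
        ≤ 1 * 1 * μ (closedBall y R) := by
          rw [one_mul, one_mul]; exact measure_mono inter_subset_right
      _ ≤ _ := by
        gcongr
        · exact_mod_cast le_max_left _ _
        · rw [← ENNReal.ofReal_one]
          exact ENNReal.ofReal_le_ofReal
            (Real.one_le_rpow ((one_le_div hR).2 hRr) ht)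
  · rcases ({x | infEDist x E < ENNReal.ofReal r} ∩ closedBall y R).eq_empty_or_nonempty with
      he | ⟨x, hx, hxy⟩
    · rw [he]; simp
    · obtain ⟨z, hz, hxz⟩ := infEDist_lt_iff.1 hx
      rw [edist_dist, ENNReal.ofReal_lt_ofReal_iff hr] at hxz
      rw [mem_closedBall] at hxy
      have hyz : dist y z ≤ 2 * R := by
        have := dist_triangle y x z
        rw [dist_comm y x] at this
        linarith
      have h1 := h z hz r (3 * R) hr (by linarith)
      rw [ENNReal.div_le_iff (hμ.measure_closedBall_ne_zero _ (by linarith))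
        (hμ.measure_closedBall_ne_top _ _)] at h1
      calc μ ({x | infEDist x E < ENNReal.ofReal r} ∩ closedBall y R)
          ≤ μ (thickening r E ∩ closedBall z (3 * R)) := by
            refine measure_mono (inter_subset_inter (fun _ h => h) ?_)
            exact closedBall_subset_closedBall' (by linarith)
        _ ≤ _ := h1
        _ ≤ ENNReal.ofReal (C * (r / R) ^ t) * (M * μ (closedBall y R)) := by
            have hle : r / (3 * R) ≤ r / R := by gcongr; linarith
            rcases le_or_gt 0 C with hC | hC
            · gcongr
              exact (measure_mono (closedBall_subset_closedBall' (ε₂ := 6 * R)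
                (by rw [dist_comm]; linarith))).trans (hM y R hR)
            · rw [ENNReal.ofReal_of_nonpos]
              · simp
              · exact mul_nonpos_of_nonpos_of_nonneg hC.le (by positivity)
        _ = ((Real.toNNReal C * M : ℝ≥0) : ℝ≥0∞) * ENNReal.ofReal ((r / R) ^ t) *
              μ (closedBall y R) := by
            rw [ENNReal.ofReal_mul' (by positivity)]
            push_cast
            rw [ENNReal.ofReal]
            ring
        _ ≤ _ := by
            gcongr
            exact_mod_cast le_max_right _ _

theorem IsThin.ae_infEDist_ne_zero {E : Set X} {t : ℝ} {A : ℝ≥0}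
    (h : IsThin μ E t A) (hμ : IsDoubling μ) (ht : 0 < t) :
    ∀ᵐ x ∂μ, infEDist x E ≠ 0 := by
  rcases isEmpty_or_nonempty X with hX | ⟨⟨y⟩⟩
  · simp [Measure.eq_zero_of_isEmpty μ]
  rw [ae_iff]
  simp only [not_not]
  have key : ∀ n : ℕ, μ ({x | infEDist x E = 0} ∩ closedBall y (n + 1 : ℝ)) = 0 := by
    intro n
    have hR : (0 : ℝ) < n + 1 := by positivity
    have hlim : Filter.Tendsto (fun r : ℝ => A * ENNReal.ofReal ((r / (n + 1)) ^ t) *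
        μ (closedBall y (n + 1 : ℝ))) (nhdsWithin 0 (Ioi 0)) (nhds 0) := by
      have h1 : Filter.Tendsto (fun r : ℝ => (r / (n + 1 : ℝ)) ^ t) (nhdsWithin 0 (Ioi 0))
          (nhds 0) := by
        have : ContinuousAt (fun r : ℝ => (r / (n + 1 : ℝ)) ^ t) 0 :=
          (continuousAt_id.div_const _).rpow_const (Or.inr ht.le)
        have h2 := this.tendsto
        simp only [zero_div, Real.zero_rpow ht.ne'] at h2
        exact h2.mono_left nhdsWithin_le_nhds
      have h2 := ENNReal.Tendsto.mul_const (b := μ (closedBall y (n + 1 : ℝ)))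
        (ENNReal.Tendsto.const_mul (a := A) (ENNReal.tendsto_ofReal h1)
          (Or.inr ENNReal.coe_ne_top)) (Or.inr (hμ.measure_closedBall_ne_top _ _))
      simpa using h2
    refine le_antisymm (ge_of_tendsto hlim ?_) bot_le
    filter_upwards [self_mem_nhdsWithin] with r hr
    refine (measure_mono (inter_subset_inter_left _ fun x hx => ?_)).trans (h y _ r hR hr)
    rw [mem_ofPred_eq] at hx ⊢
    rw [hx]
    exact ENNReal.ofReal_pos.2 hr
  refine measure_mono_null (fun x hx => ?_) (measure_iUnion_null key)
  obtain ⟨n, hn⟩ := exists_nat_ge (dist x y)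
  exact mem_iUnion.2 ⟨n, hx, mem_closedBall.2 (by linarith)⟩

/-- Layer decomposition: if `2^(-n-1) R < D ≤ 2^(-n) R`, the `n`-th summand alone dominates. The
extra factor `2` in the indicator makes the upper inequality strict, to match the open
neighbourhoods in `IsThin`. -/
theorem rpow_neg_le_add_tsum {D : ℝ≥0∞} (hD : D ≠ 0) {R s : ℝ} (hR : 0 < R) (hs : 0 ≤ s) :
    D ^ (-s) ≤ ENNReal.ofReal R ^ (-s) +
      ∑' n : ℕ, {x : ℝ≥0∞ | x < ENNReal.ofReal (2 * (1 / 2) ^ n * R)}.indicator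
        (fun _ => ENNReal.ofReal ((1 / 2) ^ (n + 1) * R) ^ (-s)) D := by
  have anti : ∀ {a b : ℝ≥0∞}, a ≤ b → b ^ (-s) ≤ a ^ (-s) := fun h =>
    ennreal_rpow_le_rpow_of_nonpos h (by linarith)
  rcases le_or_gt (ENNReal.ofReal R) D with h | h
  · exact (anti h).trans le_self_add
  · lift D to ℝ≥0 using h.ne_top
    have hD0 : (0 : ℝ) < D := by
      have : D ≠ 0 := by exact_mod_cast hD
      positivity
    have hDR : (D : ℝ) < R := by
      rw [← ENNReal.ofReal_coe_nnreal] at h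
      exact (ENNReal.ofReal_lt_ofReal_iff hR).1 h
    obtain ⟨n, hn1, hn2⟩ := exists_nat_pow_near_of_lt_one (x := (D : ℝ) / R) (y := 1 / 2)
      (by positivity) ((div_le_one hR).2 hDR.le) (by norm_num) (by norm_num)
    rw [lt_div_iff₀ hR] at hn1
    rw [div_le_iff₀ hR] at hn2
    refine le_trans ?_ le_add_self
    refine le_trans ?_ (ENNReal.le_tsum n)
    have hpos : 0 < (1 / 2 : ℝ) ^ n * R := by positivity
    rw [indicator_of_mem]
    · refine anti ?_
      rw [← ENNReal.ofReal_coe_nnreal]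
      exact ENNReal.ofReal_le_ofReal hn1.le
    · rw [mem_ofPred_eq, ← ENNReal.ofReal_coe_nnreal,
        ENNReal.ofReal_lt_ofReal_iff (by positivity)]
      linarith

/-- The layer at distance about `2^(-n) R` contributes `2^(ns)` times a proportion `2^(-nt)` of the
ball, up to constants, so `s < t` gives a convergent geometric series. -/
theorem IsThin.exists_lintegral_rpow_le [BorelSpace X] {E : Set X} {t : ℝ} {A : ℝ≥0}
    (h : IsThin μ E t A) (hμ : IsDoubling μ) {s : ℝ} (hs : 0 ≤ s) (hst : s < t) :
    ∃ A' : ℝ≥0, ∀ (y : X) (R : ℝ), 0 < R →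
      ∫⁻ x in closedBall y R, infEDist x E ^ (-s) ∂μ
        ≤ A' * ENNReal.ofReal R ^ (-s) * μ (closedBall y R) := by
  have hsum : Summable fun n : ℕ => ((1 / 2 : ℝ) ^ (n + 1)) ^ (-s) * (2 * (1 / 2) ^ n) ^ t := by
    have hg : Summable fun n : ℕ => (2 ^ s * 2 ^ t : ℝ) * ((2 : ℝ) ^ (s - t)) ^ n :=
      (summable_geometric_of_lt_one (by positivity)
        (Real.rpow_lt_one_of_one_lt_of_neg one_lt_two (by linarith))).mul_left _
    refine hg.congr fun n => ?_
    have e : (1 / 2 : ℝ) = 2 ^ (-1 : ℝ) := by rw [Real.rpow_neg_one]; norm_num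
    rw [e, ← Real.rpow_natCast, ← Real.rpow_natCast, ← Real.rpow_natCast,
      ← Real.rpow_mul two_pos.le, ← Real.rpow_mul two_pos.le, ← Real.rpow_mul two_pos.le,
      ← Real.rpow_mul two_pos.le,
      Real.mul_rpow two_pos.le (by positivity), ← Real.rpow_mul two_pos.le,
      ← Real.rpow_add two_pos, ← Real.rpow_add two_pos, ← Real.rpow_add two_pos,
      ← Real.rpow_add two_pos]
    congr 1
    push_cast
    ring
  set S : ℝ≥0∞ := ∑' n : ℕ, ENNReal.ofReal (((1 / 2 : ℝ) ^ (n + 1)) ^ (-s) *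
    (2 * (1 / 2) ^ n) ^ t) with hS
  have hStop : S ≠ ∞ := hsum.tsum_ofReal_ne_top
  refine ⟨1 + A * S.toNNReal, fun y R hR => ?_⟩
  have hE : ∀ᵐ x ∂(μ.restrict (closedBall y R)), infEDist x E ≠ 0 := by
    exact ae_restrict_of_ae (h.ae_infEDist_ne_zero hμ (hs.trans_lt hst))
  set F : ℕ → Set X := fun n => {x | infEDist x E < ENNReal.ofReal (2 * (1 / 2) ^ n * R)}
  have hF : ∀ n, MeasurableSet (F n) := fun n =>
    measurable_infEDist measurableSet_Iio
  calc ∫⁻ x in closedBall y R, infEDist x E ^ (-s) ∂μ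
      ≤ ∫⁻ x in closedBall y R, (ENNReal.ofReal R ^ (-s) + ∑' n : ℕ, (F n).indicator
          (fun _ => ENNReal.ofReal ((1 / 2) ^ (n + 1) * R) ^ (-s)) x) ∂μ := by
        refine lintegral_mono_ae ?_
        filter_upwards [hE] with x hx
        exact rpow_neg_le_add_tsum hx hR hs
    _ = ENNReal.ofReal R ^ (-s) * μ (closedBall y R) + ∑' n : ℕ,
          ENNReal.ofReal ((1 / 2) ^ (n + 1) * R) ^ (-s) * μ (F n ∩ closedBall y R) := by
        rw [lintegral_add_left measurable_const, lintegral_tsum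
          (fun n => (measurable_const.indicator (hF n)).aemeasurable)]
        simp [lintegral_indicator_const (hF _), Measure.restrict_apply (hF _)]
    _ ≤ ENNReal.ofReal R ^ (-s) * μ (closedBall y R) + ∑' n : ℕ,
          A * (ENNReal.ofReal R ^ (-s) * μ (closedBall y R)) *
            ENNReal.ofReal (((1 / 2 : ℝ) ^ (n + 1)) ^ (-s) * (2 * (1 / 2) ^ n) ^ t) := by
        refine add_le_add le_rfl (ENNReal.tsum_le_tsum fun n => ?_)
        refine (mul_le_mul_right (h y R (2 * (1 / 2) ^ n * R) hR (by positivity)) _).trans_eq ?_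
        rw [mul_div_cancel_right₀ _ hR.ne', ENNReal.ofReal_mul (p := (1 / 2) ^ (n + 1)) (by positivity),
          ENNReal.mul_rpow_of_ne_top ENNReal.ofReal_ne_top ENNReal.ofReal_ne_top,
          ENNReal.ofReal_mul (p := ((1 / 2 : ℝ) ^ (n + 1)) ^ (-s)) (by positivity),
          ENNReal.ofReal_rpow_of_pos (p := -s) (x := (1 / 2 : ℝ) ^ (n + 1)) (by positivity)]
        ring
    _ = _ := by
        rw [ENNReal.tsum_mul_left, ← hS]
        push_cast
        rw [ENNReal.coe_toNNReal hStop]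
        ring

/-- Fubini, after exchanging `μ (B(x, R))` for `μ (B(y, R))`, which is comparable when `dist x y ≤
R`. -/
theorem lintegral_setLAverage_le [BorelSpace X] (hμ : IsDoubling μ) :
    ∃ C : ℝ≥0, ∀ (S : Set X) (h : X → ℝ≥0∞) (R : ℝ), MeasurableSet S → Measurable h → 0 < R →
      ∫⁻ x in S, (⨍⁻ y in closedBall x R, h y ∂μ) ∂μ
        ≤ C * ∫⁻ y, h y * (μ (S ∩ closedBall y R) / μ (closedBall y R)) ∂μ := by
  have := hμ.sigmaFinite
  have := hμ.secondCountableTopology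
  obtain ⟨C, hC⟩ := hμ.exists_measure_closedBall_le_of_dist_le
  refine ⟨C, fun S h R hS hh hR => ?_⟩
  have hK : MeasurableSet {z : X × X | dist z.1 z.2 ≤ R} :=
    measurableSet_le measurable_dist measurable_const
  have hK' : MeasurableSet {z : X × X | dist z.2 z.1 ≤ R} :=
    measurableSet_le (measurable_dist.comp measurable_swap) measurable_const
  have hm : Measurable fun y => μ (closedBall y R) := measurable_measure_prodMk_left hK'
  set k : X → X → ℝ≥0∞ := fun x y =>
    {z : X × X | dist z.1 z.2 ≤ R}.indicator (fun z => h z.2 / μ (closedBall z.2 R)) (x, y)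
  have hk : Measurable (Function.uncurry k) :=
    ((hh.comp measurable_snd).div (hm.comp measurable_snd)).indicator hK
  calc ∫⁻ x in S, (⨍⁻ y in closedBall x R, h y ∂μ) ∂μ
      ≤ ∫⁻ x in S, C * ∫⁻ y, k x y ∂μ ∂μ := by
        refine lintegral_mono fun x => ?_
        rw [setLAverage_eq, ENNReal.div_eq_inv_mul, ← lintegral_const_mul _ hh,
          ← lintegral_const_mul' _ _ ENNReal.coe_ne_top,
          ← lintegral_indicator measurableSet_closedBall]
        refine lintegral_mono fun y => ?_
        by_cases hy : dist y x ≤ R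
        · rw [indicator_of_mem (mem_closedBall.2 hy)]
          simp only [k]
          rw [indicator_of_mem (by rwa [mem_ofPred_eq, dist_comm]), ENNReal.div_eq_inv_mul,
            ← mul_assoc]
          gcongr
          rw [ENNReal.inv_le_iff_inv_le, ENNReal.mul_inv (by simp [hμ.measure_closedBall_ne_zero y hR])
            (by simp)]
          rw [inv_inv]
          rcases eq_or_ne (C : ℝ≥0∞) 0 with h0 | h0
          · rw [h0]
            have := hC y x R hR hy
            rw [h0, zero_mul] at this
            exact absurd (le_antisymm this bot_le) (hμ.measure_closedBall_ne_zero y hR)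
          · rw [mul_comm, ← div_eq_mul_inv]
            exact ENNReal.div_le_of_le_mul' (hC y x R hR hy)
        · rw [indicator_of_notMem (by simpa using hy)]
          exact bot_le
    _ = C * ∫⁻ x in S, ∫⁻ y, k x y ∂μ ∂μ := lintegral_const_mul' _ _ ENNReal.coe_ne_top
    _ = C * ∫⁻ y, ∫⁻ x in S, k x y ∂μ ∂μ := by rw [lintegral_lintegral_swap hk.aemeasurable]
    _ = _ := by
        congr 1
        refine lintegral_congr fun y => ?_
        have e : ∀ x, k x y = (closedBall y R).indicator
            (fun _ => h y / μ (closedBall y R)) x := fun x => by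
          by_cases hx : dist x y ≤ R <;> simp [k, hx]
        simp_rw [e]
        rw [lintegral_indicator_const measurableSet_closedBall,
          Measure.restrict_apply measurableSet_closedBall, inter_comm, ENNReal.div_eq_inv_mul,
          ENNReal.div_eq_inv_mul]
        ring

end Thin
-- Sums over dyadic scales.
section Sums

/-- Bounding each term by `w i * S ^ (1 / p)` and adding up replaces Hölder's inequality for series,
and works for every `p > 0`. -/
theorem rpow_tsum_le_mul_tsum {ι : Type*} (a w : ι → ℝ≥0∞) {p : ℝ} (hp : 0 < p)
    (hw0 : ∀ i, w i ≠ 0) (hw : ∀ i, w i ≠ ∞) :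
    (∑' i, a i) ^ p ≤ (∑' i, w i) ^ p * ∑' i, w i ^ (-p) * a i ^ p := by
  set S := ∑' i, w i ^ (-p) * a i ^ p with hS
  have h : ∀ i, a i ≤ w i * S ^ (1 / p) := by
    intro i
    have h1 : ((w i)⁻¹ * a i) ^ p ≤ S := by
      rw [ENNReal.mul_rpow_of_nonneg _ _ hp.le, ENNReal.inv_rpow, ← ENNReal.rpow_neg]
      exact ENNReal.le_tsum (f := fun i => w i ^ (-p) * a i ^ p) i
    have h2 : (w i)⁻¹ * a i ≤ S ^ (1 / p) := by
      rw [one_div]; exact (ENNReal.le_rpow_inv_iff hp).2 h1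
    calc a i = w i * ((w i)⁻¹ * a i) := by
          rw [← mul_assoc, ENNReal.mul_inv_cancel (hw0 i) (hw i), one_mul]
      _ ≤ _ := by gcongr
  calc (∑' i, a i) ^ p ≤ ((∑' i, w i) * S ^ (1 / p)) ^ p := by
        rw [← ENNReal.tsum_mul_right]
        exact ENNReal.rpow_le_rpow (ENNReal.tsum_le_tsum h) hp.le
    _ = _ := by
        rw [ENNReal.mul_rpow_of_nonneg _ _ hp.le, ← ENNReal.rpow_mul, one_div_mul_cancel hp.ne',
          ENNReal.rpow_one]

theorem two_rpow_eq_ofReal (x : ℝ) : (2 : ℝ≥0∞) ^ x = ENNReal.ofReal (2 ^ x) := by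
  rw [← ENNReal.ofReal_rpow_of_pos two_pos]; simp

theorem two_rpow_add (x y : ℝ) : (2 : ℝ≥0∞) ^ (x + y) = 2 ^ x * 2 ^ y :=
  ENNReal.rpow_add _ _ two_ne_zero ENNReal.ofNat_ne_top

theorem two_rpow_ne_zero (x : ℝ) : (2 : ℝ≥0∞) ^ x ≠ 0 := by
  rw [two_rpow_eq_ofReal]; exact (ENNReal.ofReal_pos.2 (by positivity)).ne'

theorem two_rpow_ne_top (x : ℝ) : (2 : ℝ≥0∞) ^ x ≠ ∞ := by
  rw [two_rpow_eq_ofReal]; exact ENNReal.ofReal_ne_top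

theorem tsum_two_rpow_neg_mul_abs_ne_top {σ : ℝ} (hσ : 0 < σ) :
    ∑' i : ℤ, (2 : ℝ≥0∞) ^ (-(σ * |(i : ℝ)|)) ≠ ∞ := by
  have hg : Summable fun n : ℕ => ((2 : ℝ) ^ (-σ)) ^ n :=
    summable_geometric_of_lt_one (by positivity)
      (Real.rpow_lt_one_of_one_lt_of_neg one_lt_two (by linarith))
  have hs : Summable fun i : ℤ => (2 : ℝ) ^ (-(σ * |(i : ℝ)|)) := by
    refine Summable.of_nat_of_neg (hg.congr fun n => ?_) (hg.congr fun n => ?_) <;>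
    · rw [← Real.rpow_natCast, ← Real.rpow_mul two_pos.le]
      congr 1
      simp
  simp_rw [two_rpow_eq_ofReal]
  exact hs.tsum_ofReal_ne_top

theorem tsum_two_rpow_neg_mul_abs_sub (σ : ℝ) (j : ℤ) :
    ∑' i : ℤ, (2 : ℝ≥0∞) ^ (-(σ * |(i : ℝ) - j|)) = ∑' i : ℤ, (2 : ℝ≥0∞) ^ (-(σ * |(i : ℝ)|)) := by
  rw [← (Equiv.subRight j).tsum_eq fun i : ℤ => (2 : ℝ≥0∞) ^ (-(σ * |(i : ℝ)|))]
  simp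

/-- Since `φ (max i j) ≤ φ i + φ j`, one index is always free to be summed against the decaying
weight. -/
theorem tsum_tsum_max_le (σ : ℝ) (φ : ℤ → ℝ≥0∞) :
    ∑' j : ℤ, ∑' i : ℤ, (2 : ℝ≥0∞) ^ (-(σ * |(i : ℝ) - j|)) * φ (max i j)
      ≤ 2 * (∑' i : ℤ, (2 : ℝ≥0∞) ^ (-(σ * |(i : ℝ)|))) * ∑' m, φ m := by
  set W := ∑' i : ℤ, (2 : ℝ≥0∞) ^ (-(σ * |(i : ℝ)|)) with hW
  have hmax : ∀ i j : ℤ, φ (max i j) ≤ φ i + φ j := fun i j => by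
    rcases max_choice i j with h | h <;> rw [h]
    · exact le_self_add
    · exact le_add_self
  calc _ ≤ ∑' j : ℤ, ∑' i : ℤ, ((2 : ℝ≥0∞) ^ (-(σ * |(i : ℝ) - j|)) * φ i +
        (2 : ℝ≥0∞) ^ (-(σ * |(i : ℝ) - j|)) * φ j) := by
        refine ENNReal.tsum_le_tsum fun j => ENNReal.tsum_le_tsum fun i => ?_
        rw [← mul_add]
        gcongr
        exact hmax i j
    _ = (∑' i : ℤ, ∑' j : ℤ, (2 : ℝ≥0∞) ^ (-(σ * |(i : ℝ) - j|)) * φ i) +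
        ∑' j : ℤ, ∑' i : ℤ, (2 : ℝ≥0∞) ^ (-(σ * |(i : ℝ) - j|)) * φ j := by
        simp_rw [ENNReal.tsum_add]
        rw [ENNReal.tsum_comm]
    _ = _ := by
        have hi : ∀ i : ℤ, ∑' j : ℤ, (2 : ℝ≥0∞) ^ (-(σ * |(i : ℝ) - j|)) = W := fun i => by
          simp_rw [abs_sub_comm (i : ℝ)]
          exact tsum_two_rpow_neg_mul_abs_sub σ i
        simp_rw [ENNReal.tsum_mul_right, hi, tsum_two_rpow_neg_mul_abs_sub, ENNReal.tsum_mul_left]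
        rw [← hW]
        ring

/-- A geometric series starting at the least `m` with `D ≤ c 2^m`. The constant is kept explicit
because its behaviour as `η → 0`, of order `1 / η`, decides the case `β = 0`. -/
theorem tsum_indicator_two_rpow_le {D : ℝ≥0∞} (hD : D ≠ 0) {c η : ℝ} (hc : 0 < c) (hη : 0 < η) :
    ∑' m : ℤ, {x : ℝ≥0∞ | x ≤ ENNReal.ofReal c * 2 ^ (m : ℝ)}.indicator
        (fun _ => (2 : ℝ≥0∞) ^ (-(η * m))) D
      ≤ ENNReal.ofReal (c ^ η / (1 - 2 ^ (-η))) * D ^ (-η) := by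
  have hq : (2 : ℝ) ^ (-η) < 1 := Real.rpow_lt_one_of_one_lt_of_neg one_lt_two (by linarith)
  rcases eq_or_ne D ∞ with rfl | hDt
  · rw [ENNReal.tsum_eq_zero.2]
    · exact bot_le
    intro m
    refine indicator_of_notMem ?_ _
    simp only [mem_ofPred_eq, top_le_iff]
    exact ENNReal.mul_ne_top ENNReal.ofReal_ne_top (two_rpow_ne_top _)
  lift D to ℝ≥0 using hDt
  have hD0 : (0 : ℝ) < D := by
    have : D ≠ 0 := by exact_mod_cast hD
    positivity
  set m₀ : ℤ := ⌈Real.logb 2 (D / c)⌉ with hm₀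
  have hiff : ∀ m : ℤ, (D : ℝ≥0∞) ≤ ENNReal.ofReal c * 2 ^ (m : ℝ) ↔ m₀ ≤ m := fun m => by
    rw [two_rpow_eq_ofReal, ← ENNReal.ofReal_mul hc.le, ← ENNReal.ofReal_coe_nnreal,
      ENNReal.ofReal_le_ofReal_iff (by positivity), Int.ceil_le,
      Real.logb_le_iff_le_rpow one_lt_two (by positivity), div_le_iff₀' hc]
  have hinj : Function.Injective fun n : ℕ => m₀ + (n : ℤ) := fun a b h => by simpa using h
  rw [← hinj.tsum_eq]
  · calc ∑' n : ℕ, {x : ℝ≥0∞ | x ≤ ENNReal.ofReal c * 2 ^ ((m₀ + n : ℤ) : ℝ)}.indicator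
          (fun _ => (2 : ℝ≥0∞) ^ (-(η * (m₀ + n : ℤ)))) D
        = ∑' n : ℕ, ENNReal.ofReal (2 ^ (-(η * m₀)) * (2 ^ (-η)) ^ n) := by
          refine tsum_congr fun n => ?_
          simp only [indicator, mem_ofPred_eq]
          rw [if_pos ((hiff _).2 (by omega)), two_rpow_eq_ofReal,
            ← Real.rpow_natCast, ← Real.rpow_mul two_pos.le, ← Real.rpow_add two_pos]
          congr 2
          push_cast
          ring
      _ = ENNReal.ofReal (2 ^ (-(η * m₀)) / (1 - 2 ^ (-η))) := by
          rw [← ENNReal.ofReal_tsum_of_nonneg (fun n => by positivity)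
            ((summable_geometric_of_lt_one (by positivity) hq).mul_left _), tsum_mul_left,
            tsum_geometric_of_lt_one (by positivity) hq, div_eq_mul_inv]
      _ ≤ ENNReal.ofReal (c ^ η / (1 - 2 ^ (-η)) * (D : ℝ) ^ (-η)) := by
          refine ENNReal.ofReal_le_ofReal ?_
          rw [div_mul_eq_mul_div]
          have h1 : 0 < 1 - (2 : ℝ) ^ (-η) := by linarith
          gcongr
          have h2 : (D : ℝ) / c ≤ 2 ^ (m₀ : ℝ) :=
            (Real.logb_le_iff_le_rpow one_lt_two (by positivity)).1 (Int.le_ceil _)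
          calc (2 : ℝ) ^ (-(η * m₀)) = (2 ^ (m₀ : ℝ)) ^ (-η) := by
                rw [← Real.rpow_mul two_pos.le]; ring_nf
            _ ≤ ((D : ℝ) / c) ^ (-η) :=
                Real.rpow_le_rpow_of_nonpos (by positivity) h2 (by linarith)
            _ = _ := by
                rw [Real.div_rpow hD0.le hc.le, Real.rpow_neg hc.le, div_inv_eq_mul, mul_comm]
      _ = _ := by
          rw [ENNReal.ofReal_mul (div_nonneg (by positivity) (by linarith)),
            ← ENNReal.ofReal_rpow_of_pos hD0, ENNReal.ofReal_coe_nnreal]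
  · intro m hm
    have : m₀ ≤ m := by
      by_contra h
      refine hm (indicator_of_notMem (fun h' => h ?_) _)
      exact (hiff m).1 h'
    exact ⟨(m - m₀).toNat, by simp; omega⟩

theorem edist_le_tsum_int {a : ℤ → ℝ} {l l' : ℝ}
    (hbot : Filter.Tendsto a Filter.atBot (nhds l)) (htop : Filter.Tendsto a Filter.atTop (nhds l')) :
    edist l l' ≤ ∑' i : ℤ, edist (a i) (a (i + 1)) := by
  have h1 : Filter.Tendsto (fun n : ℕ => edist (a (-(n : ℤ))) (a n)) Filter.atTop
      (nhds (edist l l')) :=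
    (hbot.comp (Filter.tendsto_neg_atTop_atBot.comp tendsto_natCast_atTop_atTop)).edist
      (htop.comp tendsto_natCast_atTop_atTop)
  refine le_of_tendsto' h1 fun n => ?_
  have h2 := edist_le_range_sum_edist (fun k : ℕ => a (-(n : ℤ) + k)) (2 * n)
  have e : -(n : ℤ) + ((2 * n : ℕ) : ℤ) = n := by push_cast; ring
  simp only [e, Nat.cast_zero, add_zero] at h2
  refine h2.trans ?_
  have hinj : Function.Injective fun k : ℕ => -(n : ℤ) + k := fun a b h => by simpa using h
  calc _ = ∑ k ∈ Finset.range (2 * n), (fun i : ℤ => edist (a i) (a (i + 1))) (-(n : ℤ) + k) := by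
        refine Finset.sum_congr rfl fun k _ => ?_
        simp [add_assoc]
    _ = ∑ i ∈ (Finset.range (2 * n)).map ⟨_, hinj⟩, edist (a i) (a (i + 1)) := by
        rw [Finset.sum_map]; rfl
    _ ≤ _ := ENNReal.sum_le_tsum _

end Sums

/-! ### Pointwise bound by averages of the upper gradient. -/

section Telescope

variable {X : Type*} [MetricSpace X] [MeasurableSpace X] {μ : Measure X}

theorem edist_setAverage_le {X : Type*} [MeasurableSpace X] {μ : Measure X} {f : X → ℝ} {s : Set X} (hs : μ s ≠ 0) (hs' : μ s ≠ ∞)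
    (hf : IntegrableOn f s μ) (c : ℝ) :
    edist (⨍ y in s, f y ∂μ) c ≤ ⨍⁻ y in s, ‖f y - c‖ₑ ∂μ := by
  have : IsFiniteMeasure (μ.restrict s) := ⟨by simpa using hs'.lt_top⟩
  have : NeZero (μ.restrict s) := ⟨by simpa using hs⟩
  have hc : ⨍ _ in s, c ∂μ = c := setAverage_const hs hs' c
  have h : (⨍ y in s, f y ∂μ) - c = ⨍ y in s, (f y - c) ∂μ := by
    conv_lhs => rw [← hc]
    rw [average, average, average, integral_sub hf.to_average (integrable_const c)]
  rw [edist_eq_enorm_sub, h]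
  exact enorm_integral_le_lintegral_enorm _

/-- The averages over `B(x, 2^i)` run from `f x` (continuity) to `0` (integrability and infinite
mass). Consecutive ones differ by at most the doubling constant times the mean oscillation on the
larger ball. -/
theorem exists_enorm_le_tsum_laverage [BorelSpace X] (hμ : IsDoubling μ)
    (hX : ¬ Bornology.IsBounded (univ : Set X)) {q : ℝ} (hP : SupportsPoincare μ q) :
    ∃ (C : ℝ≥0) (lam : ℝ), 1 ≤ lam ∧ ∀ (f : X → ℝ) (G : X → ℝ≥0∞), Continuous f →
      HasCompactSupport f → IsUpperGradient f G → ∀ x : X,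
        ‖f x‖ₑ ≤ C * ∑' i : ℤ, (2 : ℝ≥0∞) ^ (i : ℝ) *
          (⨍⁻ y in closedBall x (lam * 2 ^ (i : ℝ)), G y ^ q ∂μ) ^ (1 / q) := by
  obtain ⟨C, lam, hlam, hP⟩ := hP
  obtain ⟨M, hM⟩ := hμ.doubling
  refine ⟨M * C, lam, hlam, fun f G hf hfs hG x => ?_⟩
  have := hμ.isFiniteMeasureOnCompacts
  have hint : Integrable f μ := hf.integrable_of_hasCompactSupport hfs
  set r : ℤ → ℝ := fun i => 2 ^ (i : ℝ) with hr
  have hr0 : ∀ i, 0 < r i := fun i => by positivity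
  have hr1 : ∀ i, r (i + 1) = 2 * r i := fun i => by
    simp only [hr]; push_cast; rw [Real.rpow_add two_pos, Real.rpow_one, mul_comm]
  set a : ℤ → ℝ := fun i => ⨍ y in closedBall x (r i), f y ∂μ with ha
  have h0 := fun i => hμ.measure_closedBall_ne_zero x (hr0 i)
  have ht := fun i => hμ.measure_closedBall_ne_top x (r i)
  have hbot : Filter.Tendsto a Filter.atBot (nhds (f x)) := by
    rw [EMetric.tendsto_nhds]
    intro ε hε
    have hcont := (EMetric.tendsto_nhds.1 (hf.tendsto x)) (ε / 2) (ENNReal.half_pos hε.ne')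
    obtain ⟨δ, hδ, hball⟩ := Metric.eventually_nhds_iff.1 hcont
    have hr' : Filter.Tendsto r Filter.atBot (nhds 0) :=
      (tendsto_rpow_atBot_of_base_gt_one 2 one_lt_two).comp
        (tendsto_intCast_atBot_iff.2 Filter.tendsto_id)
    filter_upwards [hr'.eventually_lt_const hδ] with i hi
    rcases eq_or_ne ε ∞ with rfl | hεt
    · exact edist_lt_top _ _
    refine lt_of_le_of_lt ?_ (ENNReal.half_lt_self hε.ne' hεt)
    calc edist (a i) (f x) ≤ ⨍⁻ y in closedBall x (r i), ‖f y - f x‖ₑ ∂μ :=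
          edist_setAverage_le (h0 i) (ht i) hint.integrableOn _
      _ ≤ ⨍⁻ _ in closedBall x (r i), ε / 2 ∂μ := by
          rw [setLAverage_eq, setLAverage_eq]
          gcongr 1
          refine setLIntegral_mono measurable_const fun y hy => ?_
          rw [← edist_eq_enorm_sub]
          exact (hball ((mem_closedBall.1 hy).trans_lt hi)).le
      _ = ε / 2 := setLAverage_const (h0 i) (ht i) _
  have htop : Filter.Tendsto a Filter.atTop (nhds 0) := by
    have hr' : Filter.Tendsto r Filter.atTop Filter.atTop :=
      (tendsto_rpow_atTop_of_base_gt_one 2 one_lt_two).comp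
        (tendsto_intCast_atTop_iff.2 Filter.tendsto_id)
    have h2 := ENNReal.Tendsto.const_div (a := ∫⁻ y, ‖f y‖ₑ ∂μ)
      ((hμ.tendsto_measure_closedBall hX x).comp (tendsto_nat_floor_atTop.comp hr'))
      (Or.inr hint.2.ne)
    rw [ENNReal.div_top] at h2
    rw [tendsto_iff_edist_tendsto_0]
    refine tendsto_of_tendsto_of_tendsto_of_le_of_le tendsto_const_nhds h2
      (fun _ => bot_le) fun i => ?_
    calc edist (a i) 0 ≤ ⨍⁻ y in closedBall x (r i), ‖f y - 0‖ₑ ∂μ :=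
          edist_setAverage_le (h0 i) (ht i) hint.integrableOn _
      _ ≤ _ := by
          rw [setLAverage_eq]
          simp only [sub_zero]
          refine ENNReal.div_le_div (setLIntegral_le_lintegral _ _) (measure_mono ?_)
          exact closedBall_subset_closedBall (Nat.floor_le (hr0 i).le)
  have h1 := edist_le_tsum_int hbot htop
  rw [edist_zero_right] at h1
  refine h1.trans ?_
  set T : ℤ → ℝ≥0∞ := fun i => (2 : ℝ≥0∞) ^ (i : ℝ) *
    (⨍⁻ y in closedBall x (lam * r i), G y ^ q ∂μ) ^ (1 / q) with hT
  calc ∑' i : ℤ, edist (a i) (a (i + 1)) ≤ ∑' i : ℤ, ((M * C : ℝ≥0) : ℝ≥0∞) * T (i + 1) := by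
        refine ENNReal.tsum_le_tsum fun i => ?_
        calc edist (a i) (a (i + 1))
            ≤ ⨍⁻ y in closedBall x (r i), ‖f y - a (i + 1)‖ₑ ∂μ :=
              edist_setAverage_le (h0 i) (ht i) hint.integrableOn _
          _ ≤ M * ⨍⁻ y in closedBall x (r (i + 1)), ‖f y - a (i + 1)‖ₑ ∂μ := by
              rw [setLAverage_eq, setLAverage_eq]
              refine ENNReal.div_le_of_le_mul ?_
              have hsub : closedBall x (r i) ⊆ closedBall x (r (i + 1)) :=
                closedBall_subset_closedBall (by rw [hr1]; linarith [hr0 i])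
              calc ∫⁻ y in closedBall x (r i), ‖f y - a (i + 1)‖ₑ ∂μ
                  ≤ ∫⁻ y in closedBall x (r (i + 1)), ‖f y - a (i + 1)‖ₑ ∂μ :=
                    lintegral_mono_set hsub
                _ = ((∫⁻ y in closedBall x (r (i + 1)), ‖f y - a (i + 1)‖ₑ ∂μ) /
                      μ (closedBall x (r (i + 1)))) * μ (closedBall x (r (i + 1))) :=
                    (ENNReal.div_mul_cancel (h0 _) (ht _)).symm
                _ ≤ ((∫⁻ y in closedBall x (r (i + 1)), ‖f y - a (i + 1)‖ₑ ∂μ) /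
                      μ (closedBall x (r (i + 1)))) * (M * μ (closedBall x (r i))) := by
                    gcongr
                    rw [hr1]
                    exact hM x _ (hr0 i)
                _ = _ := by ring
          _ ≤ M * (C * ENNReal.ofReal (r (i + 1)) *
                (⨍⁻ y in closedBall x (lam * r (i + 1)), G y ^ q ∂μ) ^ (1 / q)) := by
              gcongr
              exact hP f G (fun _ _ => hint.integrableOn) hG x _ (hr0 _)
          _ = _ := by
              simp only [hT, hr]
              rw [two_rpow_eq_ofReal]
              push_cast
              ring
    _ = _ := by
        rw [ENNReal.tsum_mul_left]
        congr 1
        exact (Equiv.addRight (1 : ℤ)).tsum_eq T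

end Telescope
-- The weighted inequality with a gain `η > 0`.
section Main

variable {X : Type*} [MetricSpace X] [MeasurableSpace X] {μ : Measure X}

theorem IsDoubling.measurable_setLAverage_closedBall [BorelSpace X] (hμ : IsDoubling μ)
    {h : X → ℝ≥0∞} (hh : Measurable h) (R : ℝ) :
    Measurable fun x => ⨍⁻ y in closedBall x R, h y ∂μ := by
  have := hμ.sigmaFinite
  have := hμ.secondCountableTopology
  have hK : MeasurableSet {z : X × X | dist z.2 z.1 ≤ R} :=
    measurableSet_le (measurable_dist.comp measurable_swap) measurable_const
  have hm : Measurable fun y => μ (closedBall y R) := measurable_measure_prodMk_left hK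
  have hn : Measurable fun x => ∫⁻ y, {z : X × X | dist z.2 z.1 ≤ R}.indicator
      (fun z => h z.2) (x, y) ∂μ :=
    ((hh.comp measurable_snd).indicator hK).lintegral_prod_right'
  convert hn.div hm using 2 with x
  rw [setLAverage_eq, ← lintegral_indicator measurableSet_closedBall]
  rfl

/-- The points whose distance to `E` is comparable to `2 ^ j`. -/
def distShell (E : Set X) (j : ℤ) : Set X :=
  {x | infEDist x E ∈ Ico ((2 : ℝ≥0∞) ^ (j : ℝ)) (2 ^ ((j : ℝ) + 1))}

theorem measurableSet_distShell [BorelSpace X] (E : Set X) (j : ℤ) :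
    MeasurableSet (distShell E j) :=
  measurable_infEDist measurableSet_Ico

omit [MeasurableSpace X] in
theorem mem_iUnion_distShell {E : Set X} {x : X} (h0 : infEDist x E ≠ 0) (ht : infEDist x E ≠ ∞) :
    x ∈ ⋃ j, distShell E j := by
  obtain ⟨n, hn⟩ := ENNReal.exists_mem_Ico_zpow h0 ht ENNReal.one_lt_two ENNReal.ofNat_ne_top
  refine mem_iUnion.2 ⟨n, ?_⟩
  rw [← ENNReal.rpow_intCast, ← ENNReal.rpow_intCast] at hn
  simpa [distShell] using hn

/-- For `i ≥ j` thinness gives the decay; for `i ≤ j` the proportion is merely at most `1`, whence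
`1 + A`. The indicator records that a ball around `y` meeting the shell forces `d y ≤ 2^(j+1) + lam
2^i`. -/
theorem IsThin.measure_distShell_inter_div_le {E : Set X} {t : ℝ} {A : ℝ≥0}
    (h : IsThin μ E t A) (hμ : IsDoubling μ) (ht : 0 ≤ t) {lam : ℝ} (hlam : 1 ≤ lam) (i j : ℤ)
    (y : X) :
    μ (distShell E j ∩ closedBall y (lam * 2 ^ (i : ℝ))) / μ (closedBall y (lam * 2 ^ (i : ℝ)))
      ≤ ((1 + A : ℝ≥0) : ℝ≥0∞) * 2 ^ t * 2 ^ (-(t * max ((i : ℝ) - j) 0)) *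
        {x : ℝ≥0∞ | x ≤ ENNReal.ofReal (2 + lam) * 2 ^ ((max i j : ℤ) : ℝ)}.indicator 1
          (infEDist y E) := by
  set R : ℝ := lam * 2 ^ (i : ℝ) with hR
  have hR0 : 0 < R := by positivity
  have h0 := hμ.measure_closedBall_ne_zero y hR0
  have hT := hμ.measure_closedBall_ne_top y R
  rcases (distShell E j ∩ closedBall y R).eq_empty_or_nonempty with he | ⟨x, hx, hxy⟩
  · rw [he]; simp
  rw [indicator_of_mem, Pi.one_apply, mul_one]
  · rw [ENNReal.div_le_iff h0 hT]
    rcases le_total i j with hij | hij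
    · have hij' : (i : ℝ) ≤ j := by exact_mod_cast hij
      rw [max_eq_right (by linarith), mul_zero, neg_zero, ENNReal.rpow_zero, mul_one]
      refine (measure_mono inter_subset_right).trans ?_
      have h1 : (1 : ℝ≥0∞) ≤ ((1 + A : ℝ≥0) : ℝ≥0∞) * 2 ^ t := by
        refine one_le_mul (by exact_mod_cast le_self_add) ?_
        simpa using ENNReal.rpow_le_rpow_of_exponent_le (x := 2) one_le_two ht
      calc μ (closedBall y R) = 1 * μ (closedBall y R) := (one_mul _).symm
        _ ≤ _ := by gcongr
    · have hij' : (j : ℝ) ≤ i := by exact_mod_cast hij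
      rw [max_eq_left (by linarith)]
      calc μ (distShell E j ∩ closedBall y R)
          ≤ μ ({x | infEDist x E < ENNReal.ofReal (2 ^ ((j : ℝ) + 1))} ∩ closedBall y R) := by
            refine measure_mono (inter_subset_inter_left _ fun z hz => ?_)
            rw [mem_ofPred_eq, ← two_rpow_eq_ofReal]
            exact hz.2
        _ ≤ A * ENNReal.ofReal ((2 ^ ((j : ℝ) + 1) / R) ^ t) * μ (closedBall y R) :=
            h y R _ hR0 (by positivity)
        _ ≤ ((1 + A : ℝ≥0) : ℝ≥0∞) * (2 ^ t * 2 ^ (-(t * ((i : ℝ) - j)))) *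
              μ (closedBall y R) := by
            gcongr
            · exact le_add_self
            · rw [← two_rpow_add, two_rpow_eq_ofReal]
              refine ENNReal.ofReal_le_ofReal ?_
              calc ((2 : ℝ) ^ ((j : ℝ) + 1) / R) ^ t ≤ (2 ^ ((j : ℝ) + 1) / 2 ^ (i : ℝ)) ^ t := by
                    gcongr
                    exact le_mul_of_one_le_left (by positivity) hlam
                _ = _ := by
                    rw [← Real.rpow_sub two_pos, ← Real.rpow_mul two_pos.le]
                    ring_nf
        _ = _ := by ring
  · rw [mem_ofPred_eq]
    have hi : (2 : ℝ≥0∞) ^ (i : ℝ) ≤ 2 ^ ((max i j : ℤ) : ℝ) :=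
      ENNReal.rpow_le_rpow_of_exponent_le one_le_two (by exact_mod_cast le_max_left i j)
    have hj : (2 : ℝ≥0∞) ^ (j : ℝ) ≤ 2 ^ ((max i j : ℤ) : ℝ) :=
      ENNReal.rpow_le_rpow_of_exponent_le one_le_two (by exact_mod_cast le_max_right i j)
    calc infEDist y E ≤ infEDist x E + edist y x := infEDist_le_infEDist_add_edist
      _ ≤ 2 ^ ((j : ℝ) + 1) + ENNReal.ofReal R := by
          gcongr
          · exact hx.2.le
          · rw [edist_comm, edist_dist]
            exact ENNReal.ofReal_le_ofReal hxy
      _ = 2 * 2 ^ (j : ℝ) + ENNReal.ofReal lam * 2 ^ (i : ℝ) := by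
          rw [two_rpow_add, ENNReal.rpow_one, mul_comm, hR, ENNReal.ofReal_mul (by linarith),
            two_rpow_eq_ofReal (i : ℝ)]
      _ ≤ 2 * 2 ^ ((max i j : ℤ) : ℝ) + ENNReal.ofReal lam * 2 ^ ((max i j : ℤ) : ℝ) := by gcongr
      _ = _ := by
          rw [ENNReal.ofReal_add zero_le_two (by linarith), ENNReal.ofReal_ofNat, add_mul]

/-- Bookkeeping of all powers of `2`. Scales below the shell (`i ≤ j`) use `δ < p` with room `2σ`;
scales above it use `t > p - δ + η` with the same room. -/
theorem exponent_le {p δ η σ t : ℝ} (hδσ : 2 * σ ≤ p - δ) (hηt : p - δ + η + 2 * σ ≤ t) (i j : ℝ) :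
    j * (δ - η - p) + σ * |i - j| + i * (p - δ) - t * max (i - j) 0
      ≤ -(σ * |i - j|) - η * max i j := by
  rcases le_total i j with h | h
  · rw [max_eq_right (by linarith : i - j ≤ 0), max_eq_right h, abs_of_nonpos (by linarith)]
    nlinarith [mul_nonneg (sub_nonneg.2 h) (sub_nonneg.2 hδσ)]
  · rw [max_eq_left (by linarith : 0 ≤ i - j), max_eq_left h, abs_of_nonneg (by linarith)]
    nlinarith [mul_nonneg (sub_nonneg.2 h) (sub_nonneg.2 hηt)]

/-- The constants `C` and `c` are chosen before `η`, so that `η → 0` can be taken later with all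
dependence on `η` in the displayed factor. -/
theorem exists_weighted_hardy_of_isThin [BorelSpace X] (hμ : IsDoubling μ)
    (hX : ¬ Bornology.IsBounded (univ : Set X)) {E : Set X} (hE : E.Nonempty)
    {p q δ σ t : ℝ} {A : ℝ≥0} (hp : 0 < p) (hδ : 0 ≤ δ) (hσ : 0 < σ)
    (hδσ : 2 * σ ≤ p - δ) (ht : 0 < t) (hthin : IsThin μ E t A) (hP : SupportsPoincare μ q)
    (hH : ∃ K : ℝ≥0, ∀ G : X → ℝ≥0∞, Measurable G → ∀ (x : X) (R : ℝ), 0 < R →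
      (⨍⁻ y in closedBall x R, G y ^ q ∂μ) ^ (p / q)
        ≤ K * ENNReal.ofReal R ^ (-δ) *
          ⨍⁻ y in closedBall x R, G y ^ p * infEDist y E ^ δ ∂μ) :
    ∃ (C : ℝ≥0) (c : ℝ), 1 ≤ c ∧ ∀ η : ℝ, 0 < η → p - δ + η + 2 * σ ≤ t →
      ∀ (f : X → ℝ) (G : X → ℝ≥0∞), Continuous f → HasCompactSupport f → IsUpperGradient f G →
        ∫⁻ x, ‖f x‖ₑ ^ p * infEDist x E ^ (δ - η - p) ∂μ
          ≤ C * ENNReal.ofReal (c ^ η / (1 - 2 ^ (-η))) *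
            ∫⁻ x, G x ^ p * infEDist x E ^ (δ - η) ∂μ := by
  obtain ⟨K, hK⟩ := hH
  obtain ⟨C₁, lam, hlam, hC₁⟩ := exists_enorm_le_tsum_laverage hμ hX hP
  obtain ⟨C₂, hC₂⟩ := lintegral_setLAverage_le hμ
  have hε : 0 < σ / p := by positivity
  set V : ℝ≥0∞ := ∑' i : ℤ, (2 : ℝ≥0∞) ^ (-(σ / p * |(i : ℝ)|)) with hV
  have hVt : V ≠ ∞ := tsum_two_rpow_neg_mul_abs_ne_top hε
  set W : ℝ≥0∞ := ∑' i : ℤ, (2 : ℝ≥0∞) ^ (-(σ * |(i : ℝ)|)) with hW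
  have hWt : W ≠ ∞ := tsum_two_rpow_neg_mul_abs_ne_top hσ
  set M : ℝ≥0∞ := ((1 + A : ℝ≥0) : ℝ≥0∞) * 2 ^ t with hM
  have hMt : M ≠ ∞ := ENNReal.mul_ne_top ENNReal.coe_ne_top (two_rpow_ne_top t)
  set L : ℝ≥0∞ := (C₁ : ℝ≥0∞) ^ p * V ^ p * K with hL
  have hLt : L ≠ ∞ := ENNReal.mul_ne_top (ENNReal.mul_ne_top
    (ENNReal.rpow_ne_top_of_nonneg hp.le ENNReal.coe_ne_top)
    (ENNReal.rpow_ne_top_of_nonneg hp.le hVt)) ENNReal.coe_ne_top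
  have hTt : L * C₂ * M * (2 * W) ≠ ∞ := ENNReal.mul_ne_top (ENNReal.mul_ne_top
    (ENNReal.mul_ne_top hLt ENNReal.coe_ne_top) hMt) (ENNReal.mul_ne_top ENNReal.ofNat_ne_top hWt)
  refine ⟨(L * C₂ * M * (2 * W)).toNNReal, 2 + lam, by linarith, fun η hη hηt f G hf hfs hG => ?_⟩
  rw [ENNReal.coe_toNNReal hTt]
  set D : X → ℝ≥0∞ := fun x => infEDist x E with hD
  have hDm : Measurable D := measurable_infEDist
  have hD0 : ∀ᵐ x ∂μ, D x ≠ 0 := hthin.ae_infEDist_ne_zero hμ ht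
  have hDt : ∀ x, D x ≠ ∞ := fun x => infEDist_ne_top hE
  set h : X → ℝ≥0∞ := fun y => G y ^ p * D y ^ δ with hh
  have hhm : Measurable h := (hG.measurable.pow_const p).mul (hDm.pow_const δ)
  set a : ℤ → X → ℝ≥0∞ := fun i x => ⨍⁻ y in closedBall x (lam * 2 ^ (i : ℝ)), h y ∂μ with ha
  have ham : ∀ i, Measurable (a i) := fun i => hμ.measurable_setLAverage_closedBall hhm _
  -- The weights `2^(-(σ/p)|i-j|)` have a sum independent of `j`; their price is the factor
  -- `2^(σ|i-j|)`, repaid by `exponent_le`.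
  have hpow : ∀ (j : ℤ) (x : X), ‖f x‖ₑ ^ p ≤ L * ∑' i : ℤ,
      (2 : ℝ≥0∞) ^ (σ * |(i : ℝ) - j| + i * (p - δ)) * a i x := by
    intro j x
    calc ‖f x‖ₑ ^ p ≤ (C₁ * ∑' i : ℤ, (2 : ℝ≥0∞) ^ (i : ℝ) *
          (⨍⁻ y in closedBall x (lam * 2 ^ (i : ℝ)), G y ^ q ∂μ) ^ (1 / q)) ^ p :=
          ENNReal.rpow_le_rpow (hC₁ f G hf hfs hG x) hp.le
      _ ≤ (C₁ : ℝ≥0∞) ^ p * (V ^ p * ∑' i : ℤ, ((2 : ℝ≥0∞) ^ (-(σ / p * |(i : ℝ) - j|))) ^ (-p) *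
          ((2 : ℝ≥0∞) ^ (i : ℝ) *
          (⨍⁻ y in closedBall x (lam * 2 ^ (i : ℝ)), G y ^ q ∂μ) ^ (1 / q)) ^ p) := by
          rw [ENNReal.mul_rpow_of_nonneg _ _ hp.le, hV,
            ← tsum_two_rpow_neg_mul_abs_sub (σ / p) j]
          gcongr
          exact rpow_tsum_le_mul_tsum _ _ hp (fun _ => two_rpow_ne_zero _)
            (fun _ => two_rpow_ne_top _)
      _ ≤ (C₁ : ℝ≥0∞) ^ p * (V ^ p * ∑' i : ℤ, K *
          ((2 : ℝ≥0∞) ^ (σ * |(i : ℝ) - j| + i * (p - δ)) * a i x)) := by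
          refine mul_le_mul_right (mul_le_mul_right (ENNReal.tsum_le_tsum fun i => ?_) _) _
          have hr : (0 : ℝ) < lam * 2 ^ (i : ℝ) := by positivity
          have e1 : ((2 : ℝ≥0∞) ^ (-(σ / p * |(i : ℝ) - j|))) ^ (-p) = 2 ^ (σ * |(i : ℝ) - j|) := by
            rw [← ENNReal.rpow_mul]
            congr 1
            field_simp
          have e2 : ENNReal.ofReal (lam * 2 ^ (i : ℝ)) ^ (-δ) ≤ 2 ^ (-(i * δ)) := by
            rw [ENNReal.ofReal_rpow_of_pos hr, two_rpow_eq_ofReal]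
            refine ENNReal.ofReal_le_ofReal ?_
            rw [← mul_neg, Real.rpow_mul two_pos.le]
            refine Real.rpow_le_rpow_of_nonpos (by positivity) ?_ (by linarith)
            exact le_mul_of_one_le_left (by positivity) hlam
          rw [e1, ENNReal.mul_rpow_of_nonneg _ _ hp.le, ← ENNReal.rpow_mul, ← ENNReal.rpow_mul,
            one_div_mul_eq_div]
          calc _ ≤ (2 : ℝ≥0∞) ^ (σ * |(i : ℝ) - j|) * (2 ^ (i * p) *
                (K * 2 ^ (-(i * δ)) * a i x)) := by
                gcongr
                exact (hK G hG.measurable x _ hr).trans (by gcongr)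
            _ = K * (2 ^ (σ * |(i : ℝ) - j|) * (2 ^ (i * p) * 2 ^ (-(i * δ))) * a i x) := by ring
            _ = _ := by
                rw [← two_rpow_add, ← two_rpow_add]
                ring_nf
      _ = _ := by
          rw [ENNReal.tsum_mul_left, hL]
          ring
  -- `φ m y` is the part of the kernel that depends only on `m = max i j`; its sum over `m` produces
  -- `d(y)^(-η)`.
  set φ : ℤ → X → ℝ≥0∞ := fun m y => {x : ℝ≥0∞ | x ≤ ENNReal.ofReal (2 + lam) *
    2 ^ (m : ℝ)}.indicator (fun _ => (2 : ℝ≥0∞) ^ (-(η * m))) (D y) with hφ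
  have hφm : ∀ m, Measurable (φ m) := fun m =>
    (measurable_const.indicator measurableSet_Iic).comp hDm
  have hshell : ∀ j : ℤ, ∫⁻ x in distShell E j, ‖f x‖ₑ ^ p * D x ^ (δ - η - p) ∂μ
      ≤ L * C₂ * M * ∑' i : ℤ, ∫⁻ y, h y * (2 ^ (-(σ * |(i : ℝ) - j|)) * φ (max i j) y) ∂μ := by
    intro j
    calc ∫⁻ x in distShell E j, ‖f x‖ₑ ^ p * D x ^ (δ - η - p) ∂μ
        ≤ ∫⁻ x in distShell E j, (L * ∑' i : ℤ,
            (2 : ℝ≥0∞) ^ (σ * |(i : ℝ) - j| + i * (p - δ)) * a i x) * 2 ^ (j * (δ - η - p)) ∂μ := by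
          refine setLIntegral_mono' (measurableSet_distShell E j) fun x hx => ?_
          gcongr
          · exact hpow j x
          · rw [ENNReal.rpow_mul]
            have hneg : δ - η - p ≤ 0 := by linarith
            exact ennreal_rpow_le_rpow_of_nonpos hx.1 (by linarith)
      _ = L * ∑' i : ℤ, (2 : ℝ≥0∞) ^ (j * (δ - η - p) + σ * |(i : ℝ) - j| + i * (p - δ)) *
            ∫⁻ x in distShell E j, a i x ∂μ := by
          have : ∀ x, (L * ∑' i : ℤ, (2 : ℝ≥0∞) ^ (σ * |(i : ℝ) - j| + i * (p - δ)) * a i x) *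
              2 ^ (j * (δ - η - p)) = L * ∑' i : ℤ,
              (2 : ℝ≥0∞) ^ (j * (δ - η - p) + σ * |(i : ℝ) - j| + i * (p - δ)) * a i x := by
            intro x
            rw [mul_assoc, ← ENNReal.tsum_mul_right]
            congr 2
            ext i
            rw [add_assoc, two_rpow_add (j * (δ - η - p))]
            ring
          simp_rw [this]
          rw [lintegral_const_mul' _ _ hLt,
            lintegral_tsum fun i => ((ham i).const_mul _).aemeasurable]
          congr 2
          ext i
          rw [lintegral_const_mul _ (ham i)]
      _ ≤ L * ∑' i : ℤ, C₂ * M * ∫⁻ y, h y * (2 ^ (-(σ * |(i : ℝ) - j|)) * φ (max i j) y) ∂μ := by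
          refine mul_le_mul_right (ENNReal.tsum_le_tsum fun i => ?_) _
          have hθ := fun y => hthin.measure_distShell_inter_div_le hμ ht.le hlam i j y
          calc _ ≤ (2 : ℝ≥0∞) ^ (j * (δ - η - p) + σ * |(i : ℝ) - j| + i * (p - δ)) * (C₂ *
                ∫⁻ y, h y * (M * 2 ^ (-(t * max ((i : ℝ) - j) 0)) *
                {x : ℝ≥0∞ | x ≤ ENNReal.ofReal (2 + lam) * 2 ^ ((max i j : ℤ) : ℝ)}.indicator 1
                (D y)) ∂μ) := by
                refine mul_le_mul_right ((hC₂ _ h _ (measurableSet_distShell E j) hhm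
                  (by positivity)).trans ?_) _
                gcongr with y
                exact hθ y
            _ = C₂ * M * ∫⁻ y, (2 : ℝ≥0∞) ^ (j * (δ - η - p) + σ * |(i : ℝ) - j| + i * (p - δ) -
                t * max ((i : ℝ) - j) 0) * (h y *
                {x : ℝ≥0∞ | x ≤ ENNReal.ofReal (2 + lam) * 2 ^ ((max i j : ℤ) : ℝ)}.indicator 1
                (D y)) ∂μ := by
                have : ∀ y, h y * (M * 2 ^ (-(t * max ((i : ℝ) - j) 0)) *
                    {x : ℝ≥0∞ | x ≤ ENNReal.ofReal (2 + lam) *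
                      2 ^ ((max i j : ℤ) : ℝ)}.indicator 1 (D y)) =
                    (M * 2 ^ (-(t * max ((i : ℝ) - j) 0))) * (h y *
                    {x : ℝ≥0∞ | x ≤ ENNReal.ofReal (2 + lam) *
                      2 ^ ((max i j : ℤ) : ℝ)}.indicator 1 (D y)) := fun y => by ring
                simp_rw [this]
                rw [lintegral_const_mul' _ _ (ENNReal.mul_ne_top hMt (two_rpow_ne_top _)),
                  lintegral_const_mul' _ _ (two_rpow_ne_top _),
                  sub_eq_add_neg _ (t * max ((i : ℝ) - j) 0),
                  two_rpow_add _ (-(t * max ((i : ℝ) - j) 0))]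
                generalize (2 : ℝ≥0∞) ^ (-(t * max ((i : ℝ) - j) 0)) = u
                generalize (2 : ℝ≥0∞) ^ (j * (δ - η - p) + σ * |(i : ℝ) - j| + i * (p - δ)) = v
                ring
            _ ≤ _ := by
                gcongr C₂ * M * ?_
                refine lintegral_mono fun y => ?_
                simp only [hφ]
                by_cases hy : D y ≤ ENNReal.ofReal (2 + lam) * 2 ^ ((max i j : ℤ) : ℝ)
                · simp only [indicator, mem_ofPred_eq, if_pos hy, Pi.one_apply, mul_one]
                  rw [mul_comm, ← two_rpow_add]
                  gcongr
                  · exact one_le_two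
                  · have := exponent_le hδσ hηt i j
                    push_cast
                    linarith
                · simp only [indicator, mem_ofPred_eq, if_neg hy, mul_zero, le_refl]
      _ = _ := by
          rw [ENNReal.tsum_mul_left]
          ring
  have hcover : μ.restrict (⋃ j, distShell E j) = μ := by
    refine Measure.restrict_eq_self_of_ae_mem ?_
    filter_upwards [hD0] with x hx
    exact mem_iUnion_distShell hx (hDt x)
  calc ∫⁻ x, ‖f x‖ₑ ^ p * D x ^ (δ - η - p) ∂μ
      = ∫⁻ x in ⋃ j, distShell E j, ‖f x‖ₑ ^ p * D x ^ (δ - η - p) ∂μ := by rw [hcover]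
    _ ≤ ∑' j : ℤ, ∫⁻ x in distShell E j, ‖f x‖ₑ ^ p * D x ^ (δ - η - p) ∂μ :=
        lintegral_iUnion_le _ _
    _ ≤ ∑' j : ℤ, L * C₂ * M * ∑' i : ℤ,
          ∫⁻ y, h y * (2 ^ (-(σ * |(i : ℝ) - j|)) * φ (max i j) y) ∂μ :=
        ENNReal.tsum_le_tsum hshell
    _ = L * C₂ * M * ∫⁻ y, h y * ∑' j : ℤ, ∑' i : ℤ,
          (2 ^ (-(σ * |(i : ℝ) - j|)) * φ (max i j) y) ∂μ := by
        rw [ENNReal.tsum_mul_left]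
        congr 1
        simp_rw [← ENNReal.tsum_mul_left]
        have hm : ∀ i j : ℤ, Measurable fun y =>
            h y * (2 ^ (-(σ * |(i : ℝ) - j|)) * φ (max i j) y) := fun i j =>
          hhm.mul ((hφm _).const_mul _)
        rw [lintegral_tsum fun j => (Measurable.tsum fun i => hm i j).aemeasurable]
        refine tsum_congr fun j => ?_
        rw [lintegral_tsum fun i => (hm i j).aemeasurable]
    _ ≤ L * C₂ * M * ∫⁻ y, (2 * W * ENNReal.ofReal ((2 + lam) ^ η / (1 - 2 ^ (-η)))) *
          (G y ^ p * D y ^ (δ - η)) ∂μ := by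
        gcongr L * C₂ * M * ?_
        refine lintegral_mono_ae ?_
        filter_upwards [hD0] with y hy
        calc _ ≤ h y * (2 * W * (ENNReal.ofReal ((2 + lam) ^ η / (1 - 2 ^ (-η))) *
                D y ^ (-η))) := by
              gcongr
              refine (tsum_tsum_max_le σ (fun m => φ m y)).trans ?_
              gcongr
              exact tsum_indicator_two_rpow_le hy (by linarith) hη
          _ = _ := by
              rw [sub_eq_add_neg δ η, ENNReal.rpow_add _ _ hy (hDt y)]
              simp only [hh]
              ring
    _ = _ := by
        rw [lintegral_const_mul' _ _ (ENNReal.mul_ne_top (ENNReal.mul_ne_top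
          ENNReal.ofNat_ne_top hWt) ENNReal.ofReal_ne_top)]
        ring

end Main
-- From `G^q` to `G^p d^δ` on balls.
section Holder

variable {X : Type*} [MetricSpace X] [MeasurableSpace X] {μ : Measure X}

/-- Hölder's inequality for `G^q = (G^p d^δ)^(q/p) d^(-δq/p)`. The dual factor is the integral of
`d^(-δq/(p-q))`, finite with the right scaling precisely because of `hδt`. -/
theorem IsThin.exists_rpow_setLAverage_le [BorelSpace X] {E : Set X} (hE : E.Nonempty) {t : ℝ}
    {A : ℝ≥0} (h : IsThin μ E t A) (hμ : IsDoubling μ) (ht : 0 < t) {p q δ : ℝ} (hq : 0 < q)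
    (hqp : q < p) (hδ : 0 ≤ δ) (hδt : δ * q / (p - q) < t) :
    ∃ K : ℝ≥0, ∀ G : X → ℝ≥0∞, Measurable G → ∀ (x : X) (R : ℝ), 0 < R →
      (⨍⁻ y in closedBall x R, G y ^ q ∂μ) ^ (p / q)
        ≤ K * ENNReal.ofReal R ^ (-δ) *
          ⨍⁻ y in closedBall x R, G y ^ p * infEDist y E ^ δ ∂μ := by
  have hp : 0 < p := hq.trans hqp
  have hpq : 0 < p - q := sub_pos.2 hqp
  obtain ⟨A', hA'⟩ := h.exists_lintegral_rpow_le hμ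
    (s := δ * q / (p - q)) (by positivity) hδt
  have hexp : 0 ≤ (p - q) / q := by positivity
  refine ⟨A' ^ ((p - q) / q), fun G hG x R hR => ?_⟩
  have hD0 : ∀ᵐ y ∂(μ.restrict (closedBall x R)), infEDist y E ≠ 0 :=
    ae_restrict_of_ae (h.ae_infEDist_ne_zero hμ ht)
  set D : X → ℝ≥0∞ := fun y => infEDist y E with hD
  have hDm : Measurable D := measurable_infEDist
  set m := μ (closedBall x R) with hm
  have hm0 : m ≠ 0 := hμ.measure_closedBall_ne_zero x hR
  have hmt : m ≠ ∞ := hμ.measure_closedBall_ne_top x R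
  set I := ∫⁻ y in closedBall x R, G y ^ p * D y ^ δ ∂μ with hI
  have hconj : (p / q).HolderConjugate (p / (p - q)) := by
    rw [Real.holderConjugate_iff]
    refine ⟨(one_lt_div hq).2 hqp, ?_⟩
    field_simp
    ring
  have hhol : ∫⁻ y in closedBall x R, G y ^ q ∂μ
      ≤ I ^ (q / p) * (A' * ENNReal.ofReal R ^ (-(δ * q / (p - q))) * m) ^ ((p - q) / p) := by
    calc ∫⁻ y in closedBall x R, G y ^ q ∂μ
        = ∫⁻ y in closedBall x R, ((fun y => (G y ^ p * D y ^ δ) ^ (q / p)) *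
            (fun y => D y ^ (-(δ * q / p)))) y ∂μ := by
          refine lintegral_congr_ae ?_
          filter_upwards [hD0] with y hy
          rw [Pi.mul_apply, ENNReal.mul_rpow_of_nonneg _ _ (by positivity), ← ENNReal.rpow_mul,
            ← ENNReal.rpow_mul, mul_assoc, ← ENNReal.rpow_add _ _ hy (infEDist_ne_top hE),
            mul_div_cancel₀ _ hp.ne', mul_div_assoc, add_neg_cancel, ENNReal.rpow_zero, mul_one]
      _ ≤ _ := ENNReal.lintegral_mul_le_Lp_mul_Lq _ hconj
            (((hG.pow_const p).mul (hDm.pow_const δ)).pow_const _).aemeasurable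
            (hDm.pow_const _).aemeasurable
      _ ≤ _ := by
          have e1 : ∀ y, ((G y ^ p * D y ^ δ) ^ (q / p)) ^ (p / q) = G y ^ p * D y ^ δ := fun y => by
            rw [← ENNReal.rpow_mul, div_mul_div_cancel₀ hp.ne', div_self hq.ne', ENNReal.rpow_one]
          have e2 : ∀ y, (D y ^ (-(δ * q / p))) ^ (p / (p - q)) = D y ^ (-(δ * q / (p - q))) :=
            fun y => by
              rw [← ENNReal.rpow_mul]
              congr 1
              field_simp
          simp_rw [e1, e2, one_div_div]
          gcongr
          exact hA' x R hR
  rw [setLAverage_eq, setLAverage_eq]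
  have hp1 : q / p * (p / q) = 1 := by field_simp
  have hp2 : (p - q) / p * (p / q) = (p - q) / q := by field_simp
  have hp3 : -(δ * q / (p - q)) * ((p - q) / q) = -δ := by field_simp
  calc ((∫⁻ y in closedBall x R, G y ^ q ∂μ) / m) ^ (p / q)
      ≤ (I ^ (q / p) * (A' * ENNReal.ofReal R ^ (-(δ * q / (p - q))) * m) ^ ((p - q) / p) / m) ^
          (p / q) := by
        gcongr
    _ = I * (A' ^ ((p - q) / q) * ENNReal.ofReal R ^ (-δ) * m ^ ((p - q) / q)) *
          m ^ (-(p / q)) := by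
        rw [ENNReal.div_eq_inv_mul, mul_comm, ENNReal.mul_rpow_of_nonneg _ _ (by positivity),
          ENNReal.mul_rpow_of_nonneg _ _ (by positivity), ← ENNReal.rpow_mul, hp1,
          ENNReal.rpow_one, ← ENNReal.rpow_mul, hp2, ENNReal.mul_rpow_of_nonneg _ _ hexp,
          ENNReal.mul_rpow_of_nonneg _ _ hexp, ← ENNReal.rpow_mul, hp3, ENNReal.inv_rpow,
          ENNReal.rpow_neg m]
    _ = (A' ^ ((p - q) / q) : ℝ≥0∞) * ENNReal.ofReal R ^ (-δ) * (I *
          (m ^ ((p - q) / q) * m ^ (-(p / q)))) := by ring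
    _ = _ := by
        rw [← ENNReal.rpow_add _ _ hm0 hmt, ENNReal.coe_rpow_of_nonneg _ hexp,
          show (p - q) / q + -(p / q) = -1 by field_simp; ring, ENNReal.rpow_neg_one,
          ← div_eq_mul_inv]

end Holder

/-! ### A product rule for upper gradients. -/

section UpperGradient

variable {X : Type*} [MetricSpace X]

theorem IsArcLengthCurve.edist_le {c : ℝ → X} {L : ℝ} (hc : IsArcLengthCurve c L) {a b : ℝ}
    (ha : 0 ≤ a) (hab : a ≤ b) (hb : b ≤ L) : edist (c a) (c b) ≤ ENNReal.ofReal (b - a) := by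
  have h := hc.2 (x := a) ⟨ha, hab.trans hb⟩ (y := b) ⟨ha.trans hab, hb⟩
  rw [NNReal.coe_one, one_mul] at h
  rw [← h]
  exact eVariationOn.edist_le c ⟨⟨ha, hab.trans hb⟩, le_rfl, hab⟩ ⟨⟨ha.trans hab, hb⟩, hab, le_rfl⟩

theorem IsArcLengthCurve.dist_le {c : ℝ → X} {L : ℝ} (hc : IsArcLengthCurve c L) {a b : ℝ}
    (ha : 0 ≤ a) (hab : a ≤ b) (hb : b ≤ L) : dist (c a) (c b) ≤ b - a := by
  have h := hc.edist_le ha hab hb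
  rwa [edist_dist, ENNReal.ofReal_le_ofReal_iff (sub_nonneg.2 hab)] at h

theorem IsArcLengthCurve.comp_add {c : ℝ → X} {L : ℝ} (hc : IsArcLengthCurve c L) {a b : ℝ}
    (ha : 0 ≤ a) (hab : a ≤ b) (hb : b ≤ L) :
    IsArcLengthCurve (fun t => c (t + a)) (b - a) := by
  refine ⟨sub_nonneg.2 hab, fun x hx y hy => ?_⟩
  have h := hc.2 (x := x + a) ⟨by linarith [hx.1], by linarith [hx.2]⟩ (y := y + a)
    ⟨by linarith [hy.1], by linarith [hy.2]⟩
  rw [add_sub_add_right_eq_sub] at h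
  rw [← h]
  have e := eVariationOn.comp_eq_of_monotoneOn c (t := Icc 0 (b - a) ∩ Icc x y) (fun t => t + a)
    (fun _ _ _ _ h => by simpa using h)
  have himg : (fun t => t + a) '' (Icc 0 (b - a) ∩ Icc x y) = Icc 0 L ∩ Icc (x + a) (y + a) := by
    rw [image_inter (add_left_injective a), image_add_const_Icc, image_add_const_Icc]
    ext t
    simp only [mem_inter_iff, mem_Icc]
    constructor
    · rintro ⟨⟨h1, h2⟩, h3, h4⟩
      exact ⟨⟨by linarith, by linarith⟩, h3, h4⟩
    · rintro ⟨⟨h1, h2⟩, h3, h4⟩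
      exact ⟨⟨by linarith [hx.1], by linarith [hy.2]⟩, h3, h4⟩
  rw [himg] at e
  exact e

theorem IsUpperGradient.le_lintegral_Ioc [MeasurableSpace X] {u : X → ℝ} {g : X → ℝ≥0∞}
    (hg : IsUpperGradient u g) {c : ℝ → X} {L : ℝ} (hc : IsArcLengthCurve c L) {a b : ℝ}
    (ha : 0 ≤ a) (hab : a ≤ b) (hb : b ≤ L) :
    ENNReal.ofReal |u (c b) - u (c a)| ≤ ∫⁻ t in Ioc a b, g (c t) := by
  have h := hg.le_lineIntegral _ _ (hc.comp_add ha hab hb)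
  have e := (measurePreserving_add_right volume a).setLIntegral_comp_preimage_emb
    (measurableEmbedding_addRight a) (fun t => g (c t)) (Icc a b)
  rw [preimage_add_const_Icc, sub_self] at e
  simp only [lineIntegral, sub_add_cancel, zero_add] at h
  rw [e] at h
  rwa [Measure.restrict_congr_set Ioc_ae_eq_Icc]

/-- Cutting `[0, L]` into `n` equal pieces makes the quadratic errors total `Q L^2 / n`, which
vanishes in the limit. Thus no differentiation along curves is needed. -/
theorem ofReal_abs_sub_le_lintegral_of_forall_le {F : ℝ → ℝ} {H : ℝ → ℝ≥0∞} {L τ Q : ℝ}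
    (hL : 0 ≤ L) (hτ : 0 < τ) (hQ : 0 ≤ Q)
    (h : ∀ a b, 0 ≤ a → a ≤ b → b ≤ L → b - a ≤ τ → ENNReal.ofReal |F b - F a|
      ≤ (∫⁻ t in Ioc a b, H t) + ENNReal.ofReal (Q * (b - a) * (b - a))) :
    ENNReal.ofReal |F L - F 0| ≤ ∫⁻ t in Ioc 0 L, H t := by
  have key : ∀ n : ℕ, 0 < n → L / n ≤ τ → ∀ k : ℕ, k ≤ n →
      ENNReal.ofReal |F (k * (L / n)) - F 0| ≤ (∫⁻ t in Ioc 0 (k * (L / n)), H t) +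
        ENNReal.ofReal (Q * (L / n) * (k * (L / n))) := by
    intro n hn hnτ k hk
    have hn' : (0 : ℝ) < n := by exact_mod_cast hn
    set s := L / n with hs
    have hs0 : 0 ≤ s := by positivity
    induction k with
    | zero => simp
    | succ k ih =>
      have hks : ((k + 1 : ℕ) : ℝ) * s ≤ L := by
        have : ((k + 1 : ℕ) : ℝ) ≤ n := by exact_mod_cast hk
        calc ((k + 1 : ℕ) : ℝ) * s ≤ n * s := by gcongr
          _ = L := by rw [hs]; field_simp
      have hle : (k : ℝ) * s ≤ ((k + 1 : ℕ) : ℝ) * s := by push_cast; nlinarith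
      have hd : ((k + 1 : ℕ) : ℝ) * s - k * s = s := by push_cast; ring
      have h1 := h (k * s) ((k + 1 : ℕ) * s) (by positivity) hle hks (by rw [hd]; exact hnτ)
      rw [hd] at h1
      rw [← Ioc_union_Ioc_eq_Ioc (a := (0 : ℝ)) (by positivity) hle, lintegral_union
        measurableSet_Ioc (by
          rw [disjoint_left]
          exact fun t ht ht' => ht'.1.not_ge ht.2)]
      calc ENNReal.ofReal |F ((k + 1 : ℕ) * s) - F 0|
          ≤ ENNReal.ofReal |F (k * s) - F 0| + ENNReal.ofReal |F ((k + 1 : ℕ) * s) - F (k * s)| := by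
            rw [add_comm (ENNReal.ofReal _), ← ENNReal.ofReal_add (abs_nonneg _) (abs_nonneg _)]
            exact ENNReal.ofReal_le_ofReal (abs_sub_le _ _ _)
        _ ≤ _ := add_le_add (ih (by omega)) h1
        _ = _ := by
            rw [show Q * s * ((k + 1 : ℕ) * s) = Q * s * (k * s) + Q * s * s by push_cast; ring,
              ENNReal.ofReal_add (by positivity) (by positivity)]
            ring
  have hlim : Filter.Tendsto (fun n : ℕ => (∫⁻ t in Ioc 0 L, H t) +
      ENNReal.ofReal (Q * (L / n) * L)) Filter.atTop (nhds (∫⁻ t in Ioc 0 L, H t)) := by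
    have h1 : Filter.Tendsto (fun n : ℕ => Q * (L / n) * L) Filter.atTop (nhds (Q * 0 * L)) :=
      ((tendsto_const_div_atTop_nhds_zero_nat L).const_mul Q).mul_const L
    have h2 := (ENNReal.tendsto_ofReal h1).const_add (∫⁻ t in Ioc 0 L, H t)
    simpa using h2
  refine ge_of_tendsto hlim ?_
  filter_upwards [Filter.eventually_gt_atTop 0,
    (tendsto_const_div_atTop_nhds_zero_nat L).eventually_le_const hτ] with n hn hn'
  have hn0 : (n : ℝ) ≠ 0 := by exact_mod_cast hn.ne'
  have := key n hn hn' n le_rfl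
  rwa [mul_div_cancel₀ _ hn0] at this

/-- Concavity of the power, in the form of Bernoulli's inequality applied to `x / y`. -/
theorem abs_rpow_sub_rpow_le {γ m x y : ℝ} (hγ0 : 0 ≤ γ) (hγ1 : γ ≤ 1) (hm : 0 < m) (hx : m ≤ x)
    (hy : m ≤ y) : |x ^ γ - y ^ γ| ≤ γ * m ^ (γ - 1) * |x - y| := by
  wlog hxy : y ≤ x generalizing x y
  · rw [abs_sub_comm, abs_sub_comm x]
    exact this hy hx (le_of_not_ge hxy)
  have hy0 : 0 < y := hm.trans_le hy
  have hx0 : 0 < x := hm.trans_le hx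
  rw [abs_of_nonneg (sub_nonneg.2 (Real.rpow_le_rpow hy0.le hxy hγ0)),
    abs_of_nonneg (sub_nonneg.2 hxy)]
  have h1 : 0 ≤ (x - y) / y := div_nonneg (sub_nonneg.2 hxy) hy0.le
  have h := rpow_one_add_le_one_add_mul_self (s := (x - y) / y) (by linarith) hγ0 hγ1
  have e : 1 + (x - y) / y = x / y := by field_simp; ring
  rw [e, Real.div_rpow hx0.le hy0.le, div_le_iff₀ (by positivity)] at h
  calc x ^ γ - y ^ γ ≤ γ * y ^ (γ - 1) * (x - y) := by
        rw [Real.rpow_sub_one hy0.ne']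
        have : (1 + γ * ((x - y) / y)) * y ^ γ = y ^ γ + γ * (y ^ γ / y) * (x - y) := by ring
        linarith
    _ ≤ _ := by
        gcongr γ * ?_ * _
        exact Real.rpow_le_rpow_of_nonpos hm hy (by linarith)

/-- On short pieces of a curve near the support of `u`, the distance to `E` changes by at most a
bounded factor, so its endpoint values may be replaced by its values along the curve. This costs the
factor `2`. -/
theorem IsUpperGradient.mul_infDist_rpow [MeasurableSpace X] [BorelSpace X] {E : Set X}
    (hE : E.Nonempty) {u : X → ℝ} {g : X → ℝ≥0∞} {K : ℝ≥0} {θ γ : ℝ} (hu : LipschitzWith K u)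
    (hg : IsUpperGradient u g) (hθ : 0 < θ) (hsupp : ∀ x, u x ≠ 0 → θ ≤ infDist x E)
    (hγ0 : 0 ≤ γ) (hγ1 : γ ≤ 1) :
    IsUpperGradient (fun x => u x * infDist x E ^ γ) (fun x => 2 * (g x * infEDist x E ^ γ +
      ENNReal.ofReal γ * ‖u x‖ₑ * infEDist x E ^ (γ - 1))) := by
  have hDm : Measurable fun x => infEDist x E := measurable_infEDist
  have hD : ∀ x, infEDist x E = ENNReal.ofReal (infDist x E) := fun x =>
    (ENNReal.ofReal_toReal (infEDist_ne_top hE)).symm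
  refine ⟨((hg.measurable.mul (hDm.pow_const γ)).add
    ((hu.continuous.measurable.enorm.const_mul _).mul (hDm.pow_const (γ - 1)))).const_mul 2,
    fun c L hc => ?_⟩
  rw [lineIntegral, ← Measure.restrict_congr_set Ioc_ae_eq_Icc]
  refine ofReal_abs_sub_le_lintegral_of_forall_le (τ := θ / 4) (Q := K * (γ * (θ / 2) ^ (γ - 1)))
    (F := fun t => u (c t) * infDist (c t) E ^ γ) hc.1 (by positivity) (by positivity)
    fun a b ha hab hb hba => ?_
  -- Otherwise an endpoint is at distance at least `θ` from `E`, and a piece of length at most `θ /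
  -- 4` stays at distance at least `3θ / 4`.
  by_cases h0 : u (c a) = 0 ∧ u (c b) = 0
  · simp [h0.1, h0.2]
  set d : ℝ → ℝ := fun t => infDist (c t) E with hd
  have hdist : ∀ s t, s ∈ Icc a b → t ∈ Icc a b → d s ≤ d t + (b - a) := by
    intro s t hs ht
    refine (infDist_le_infDist_add_dist (y := c t)).trans ?_
    gcongr
    rcases le_total s t with h | h
    · exact (hc.dist_le (ha.trans hs.1) h (ht.2.trans hb)).trans (by linarith [hs.1, ht.2])
    · rw [dist_comm]
      exact (hc.dist_le (ha.trans ht.1) h (hs.2.trans hb)).trans (by linarith [ht.1, hs.2])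
  have haI : a ∈ Icc a b := ⟨le_rfl, hab⟩
  have hbI : b ∈ Icc a b := ⟨hab, le_rfl⟩
  have hdθ : ∀ t ∈ Icc a b, 3 * θ / 4 ≤ d t := by
    intro t ht
    rw [not_and_or] at h0
    rcases h0 with h | h
    · linarith [hsupp _ h, hdist a t haI ht]
    · linarith [hsupp _ h, hdist b t hbI ht]
  set m : ℝ := min (d a) (d b) with hm
  have hmθ : θ / 2 ≤ m := le_min (by linarith [hdθ a haI]) (by linarith [hdθ b hbI])
  have hm0 : 0 < m := by linarith
  have hmt : ∀ t ∈ Icc a b, d t / 2 ≤ m := fun t ht => le_min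
    (by linarith [hdist t a ht haI, hdθ a haI]) (by linarith [hdist t b ht hbI, hdθ b hbI])
  set κ : ℝ := γ * m ^ (γ - 1) with hκ
  have hκ0 : 0 ≤ κ := by positivity
  have hκQ : κ ≤ γ * (θ / 2) ^ (γ - 1) := mul_le_mul_of_nonneg_left
    (Real.rpow_le_rpow_of_nonpos (by linarith) hmθ (by linarith)) hγ0
  have hκt : ∀ t ∈ Icc a b, κ ≤ 2 * (γ * d t ^ (γ - 1)) := by
    intro t ht
    have hdt : 0 < d t := by linarith [hdθ t ht]
    have h1 : m ^ (γ - 1) ≤ (d t / 2) ^ (γ - 1) :=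
      Real.rpow_le_rpow_of_nonpos (by positivity) (hmt t ht) (by linarith)
    have h2 : ((2 : ℝ) ^ (γ - 1))⁻¹ ≤ 2 := by
      rw [← Real.rpow_neg two_pos.le]
      calc (2 : ℝ) ^ (-(γ - 1)) ≤ 2 ^ (1 : ℝ) :=
            Real.rpow_le_rpow_of_exponent_le one_le_two (by linarith)
        _ = 2 := Real.rpow_one 2
    rw [Real.div_rpow hdt.le two_pos.le, div_eq_mul_inv] at h1
    calc κ ≤ γ * (d t ^ (γ - 1) * 2) := by
          rw [hκ]
          gcongr
          exact h1.trans (by gcongr)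
      _ = _ := by ring
  have hbt : ∀ t ∈ Icc a b, d b ^ γ ≤ 2 * d t ^ γ := by
    intro t ht
    have hdt : 0 < d t := by linarith [hdθ t ht]
    calc d b ^ γ ≤ (2 * d t) ^ γ := Real.rpow_le_rpow infDist_nonneg
          (by linarith [hdist b t hbI ht, hdθ t ht]) hγ0
      _ = 2 ^ γ * d t ^ γ := Real.mul_rpow two_pos.le hdt.le
      _ ≤ 2 ^ (1 : ℝ) * d t ^ γ := by
          gcongr
          exact one_le_two
      _ = _ := by rw [Real.rpow_one]
  -- Passing from `u (c a)` to `u (c t)` loses `K (b - a)`; multiplied by `κ (b - a)`, this is the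
  -- quadratic error admitted by the subdivision lemma.
  have hua : ∀ t ∈ Icc a b, |u (c a)| - K * (b - a) ≤ |u (c t)| := by
    intro t ht
    have h1 : |u (c a) - u (c t)| ≤ K * (b - a) := by
      rw [← Real.dist_eq]
      refine (hu.dist_le_mul _ _).trans ?_
      gcongr
      exact (hc.dist_le ha ht.1 (ht.2.trans hb)).trans (by linarith [ht.2])
    linarith [abs_sub_abs_le_abs_sub (u (c a)) (u (c t))]
  have hsplit : |u (c b) * d b ^ γ - u (c a) * d a ^ γ|
      ≤ d b ^ γ * |u (c b) - u (c a)| + (|u (c a)| - K * (b - a)) * κ * (b - a) +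
        K * (γ * (θ / 2) ^ (γ - 1)) * (b - a) * (b - a) := by
    have hdd : |d b - d a| ≤ b - a :=
      abs_sub_le_iff.2 ⟨by linarith [hdist b a hbI haI], by linarith [hdist a b haI hbI]⟩
    have h1 : |d b ^ γ - d a ^ γ| ≤ κ * (b - a) :=
      (abs_rpow_sub_rpow_le hγ0 hγ1 hm0 (min_le_right _ _) (min_le_left _ _)).trans
        (mul_le_mul_of_nonneg_left hdd hκ0)
    have e : u (c b) * d b ^ γ - u (c a) * d a ^ γ =
        d b ^ γ * (u (c b) - u (c a)) + u (c a) * (d b ^ γ - d a ^ γ) := by ring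
    have hdb : 0 ≤ d b ^ γ := Real.rpow_nonneg infDist_nonneg _
    have h2 : |u (c a)| * |d b ^ γ - d a ^ γ| ≤ |u (c a)| * (κ * (b - a)) := by gcongr
    have hba0 : 0 ≤ b - a := sub_nonneg.2 hab
    have h3 : K * κ * (b - a) * (b - a) ≤ K * (γ * (θ / 2) ^ (γ - 1)) * (b - a) * (b - a) := by
      gcongr
    calc |u (c b) * d b ^ γ - u (c a) * d a ^ γ|
        ≤ d b ^ γ * |u (c b) - u (c a)| + |u (c a)| * |d b ^ γ - d a ^ γ| := by
          rw [e]
          refine (abs_add_le _ _).trans_eq ?_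
          rw [abs_mul, abs_mul, abs_of_nonneg hdb]
      _ ≤ _ := by linarith
  have hba0 : 0 ≤ b - a := sub_nonneg.2 hab
  have hg1 := hg.le_lintegral_Ioc hc ha hab hb
  have hterm1 : ENNReal.ofReal (d b ^ γ * |u (c b) - u (c a)|)
      ≤ ∫⁻ t in Ioc a b, 2 * (g (c t) * infEDist (c t) E ^ γ) := by
    rw [ENNReal.ofReal_mul (Real.rpow_nonneg infDist_nonneg _)]
    calc _ ≤ ENNReal.ofReal (d b ^ γ) * ∫⁻ t in Ioc a b, g (c t) := by gcongr
      _ = ∫⁻ t in Ioc a b, ENNReal.ofReal (d b ^ γ) * g (c t) :=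
          (lintegral_const_mul' _ _ ENNReal.ofReal_ne_top).symm
      _ ≤ _ := by
          refine setLIntegral_mono' measurableSet_Ioc fun t ht => ?_
          have ht' := Ioc_subset_Icc_self ht
          rw [mul_comm (g (c t)), ← mul_assoc]
          gcongr
          rw [hD, ENNReal.ofReal_rpow_of_nonneg infDist_nonneg hγ0,
            ← ENNReal.ofReal_ofNat 2, ← ENNReal.ofReal_mul two_pos.le]
          exact ENNReal.ofReal_le_ofReal (hbt t ht')
  have hterm2 : ENNReal.ofReal ((|u (c a)| - K * (b - a)) * κ * (b - a)) ≤
      ∫⁻ t in Ioc a b, 2 * (ENNReal.ofReal γ * ‖u (c t)‖ₑ * infEDist (c t) E ^ (γ - 1)) := by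
    calc _ = ∫⁻ _ in Ioc a b, ENNReal.ofReal ((|u (c a)| - K * (b - a)) * κ) := by
          rw [setLIntegral_const, Real.volume_Ioc, ENNReal.ofReal_mul' hba0]
      _ ≤ _ := by
          refine setLIntegral_mono' measurableSet_Ioc fun t ht => ?_
          have ht' := Ioc_subset_Icc_self ht
          have hdt : 0 < d t := by linarith [hdθ t ht']
          rw [hD, ENNReal.ofReal_rpow_of_pos hdt, Real.enorm_eq_ofReal_abs,
            ← ENNReal.ofReal_mul hγ0, ← ENNReal.ofReal_mul (by positivity),
            ← ENNReal.ofReal_ofNat 2, ← ENNReal.ofReal_mul two_pos.le]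
          refine ENNReal.ofReal_le_ofReal ?_
          calc _ ≤ |u (c t)| * κ := by gcongr; exact hua t ht'
            _ ≤ |u (c t)| * (2 * (γ * d t ^ (γ - 1))) := by gcongr; exact hκt t ht'
            _ = _ := by ring
  calc ENNReal.ofReal |u (c b) * d b ^ γ - u (c a) * d a ^ γ|
      ≤ ENNReal.ofReal (d b ^ γ * |u (c b) - u (c a)|) +
          ENNReal.ofReal ((|u (c a)| - K * (b - a)) * κ * (b - a)) +
          ENNReal.ofReal (K * (γ * (θ / 2) ^ (γ - 1)) * (b - a) * (b - a)) :=
        (ENNReal.ofReal_le_ofReal hsplit).trans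
          (ENNReal.ofReal_add_le.trans (add_le_add_left ENNReal.ofReal_add_le _))
    _ ≤ _ := by
        gcongr
        refine (add_le_add hterm1 hterm2).trans ((le_lintegral_add _ _).trans_eq ?_)
        simp_rw [mul_add]

end UpperGradient
-- The case `β = 0` by absorption.
section Unweighted

/-- For `η ≤ 1`, Bernoulli gives `1 - 2^(-η) ≥ η / 2`, so the quantity is at most `2 c η^(p-1)`,
which tends to `0` because `p > 1`. -/
theorem exists_small_exponent {p c ε η₀ : ℝ} (hp : 1 < p) (hc : 1 ≤ c) (hε : 0 < ε)
    (hη₀ : 0 < η₀) :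
    ∃ η : ℝ, 0 < η ∧ η ≤ η₀ ∧ η ≤ 1 ∧ c ^ η / (1 - 2 ^ (-η)) * (η / p) ^ p ≤ ε := by
  have hlim : Filter.Tendsto (fun η : ℝ => 2 * c * η ^ (p - 1)) (nhdsWithin 0 (Ioi 0))
      (nhds 0) := by
    have h : ContinuousAt (fun η : ℝ => 2 * c * η ^ (p - 1)) 0 :=
      (continuousAt_id.rpow_const (Or.inr (by linarith))).const_mul _
    have h2 := h.tendsto
    simp only [Real.zero_rpow (by linarith : p - 1 ≠ 0), mul_zero] at h2
    exact h2.mono_left nhdsWithin_le_nhds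
  obtain ⟨η, hηε, ⟨hη, hη₁⟩⟩ := ((hlim.eventually_le_const hε).and
    (Ioc_mem_nhdsGT (lt_min hη₀ one_pos))).exists
  have hη1 : η ≤ 1 := hη₁.trans (min_le_right _ _)
  refine ⟨η, hη, hη₁.trans (min_le_left _ _), hη1, le_trans ?_ hηε⟩
  have h1 : η / 2 ≤ 1 - (2 : ℝ) ^ (-η) := by
    have h := rpow_one_add_le_one_add_mul_self (s := (-1 / 2 : ℝ)) (by norm_num) hη.le hη1
    have e : (2 : ℝ) ^ (-η) = (1 + -1 / 2) ^ η := by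
      rw [Real.rpow_neg two_pos.le, ← Real.inv_rpow two_pos.le]
      norm_num
    rw [e]
    linarith
  have h2 : c ^ η ≤ c := by
    calc c ^ η ≤ c ^ (1 : ℝ) := Real.rpow_le_rpow_of_exponent_le hc hη1
      _ = c := Real.rpow_one c
  have h3 : (η / p) ^ p ≤ η ^ p :=
    Real.rpow_le_rpow (by positivity) (div_le_self hη.le hp.le) (by linarith)
  have hη2 : 0 < η / 2 := by positivity
  have hc0 : 0 < c := by linarith
  calc c ^ η / (1 - 2 ^ (-η)) * (η / p) ^ p ≤ c / (η / 2) * η ^ p := by gcongr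
    _ = 2 * c * η ^ (p - 1) := by
        rw [Real.rpow_sub_one hη.ne']
        field_simp

theorem exists_pos_le_infDist_of_tsupport_subset {X : Type*} [MetricSpace X] {u : X → ℝ}
    {Ω : Set X} (hΩ : IsOpen Ω) (hE : Ωᶜ.Nonempty) (hu : HasCompactSupport u)
    (hsub : tsupport u ⊆ Ω) : ∃ θ : ℝ, 0 < θ ∧ ∀ x, u x ≠ 0 → θ ≤ infDist x Ωᶜ := by
  obtain ⟨θ, hθ, h⟩ := hu.isCompact.exists_thickening_subset_open hΩ hsub
  refine ⟨θ, hθ, fun x hx => (le_infDist hE).2 fun y hy => ?_⟩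
  by_contra! hlt
  exact hy (h (mem_thickening_iff.2 ⟨x, subset_tsupport u hx, by rwa [dist_comm]⟩))

variable {X : Type*} [MetricSpace X] [MeasurableSpace X] {μ : Measure X}

theorem lintegral_rpow_mul_infEDist_ne_top [BorelSpace X] (hμ : IsDoubling μ) {u : X → ℝ}
    {E : Set X} {p θ : ℝ} (hp : 0 < p) (hc : Continuous u) (hu : HasCompactSupport u)
    (hE : E.Nonempty) (hθ : 0 < θ) (hsupp : ∀ x, u x ≠ 0 → θ ≤ infDist x E) :
    ∫⁻ x, ‖u x‖ₑ ^ p * infEDist x E ^ (-p) ∂μ ≠ ∞ := by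
  have := hμ.isFiniteMeasureOnCompacts
  have hLp : MemLp u (ENNReal.ofReal p) μ := hc.memLp_of_hasCompactSupport hu
  have hfin := lintegral_rpow_enorm_lt_top_of_eLpNorm_lt_top
    (ENNReal.ofReal_pos.2 hp).ne' ENNReal.ofReal_ne_top hLp.2
  rw [ENNReal.toReal_ofReal hp.le] at hfin
  have hθt : ENNReal.ofReal θ ^ (-p) ≠ ∞ := by
    rw [ENNReal.ofReal_rpow_of_pos hθ]; exact ENNReal.ofReal_ne_top
  refine ne_top_of_le_ne_top (ENNReal.mul_ne_top hfin.ne hθt) ?_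
  rw [← lintegral_mul_const' _ _ hθt]
  refine lintegral_mono fun x => ?_
  by_cases hx : u x = 0
  · simp [hx, hp]
  · refine mul_le_mul_right (ennreal_rpow_le_rpow_of_nonpos ?_ (by linarith)) _
    rw [← ENNReal.ofReal_toReal (infEDist_ne_top hE (x := x))]
    exact ENNReal.ofReal_le_ofReal (hsupp x hx)

/-- For `v = u d^γ` with `γ = η / p`, the left side of the weighted inequality is exactly the wanted
integral `I`, and the right side is a multiple of `∫ g^p + γ^p I`. A small `η` brings the
coefficient of `I` down to `1/2`. -/
theorem exists_hardy_of_isThin [BorelSpace X] (hμ : IsDoubling μ)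
    (hX : ¬ Bornology.IsBounded (univ : Set X)) {Ω : Set X} (hΩ : IsOpen Ω) (hE : Ωᶜ.Nonempty)
    {p t : ℝ} {A : ℝ≥0} (hp : 1 < p) (hpt : p < t) (hthin : IsThin μ Ωᶜ t A)
    (hP : SupportsPoincare μ p) :
    ∃ C : ℝ≥0, ∀ (u : X → ℝ) (g : X → ℝ≥0∞), (∃ K : ℝ≥0, LipschitzWith K u) →
      HasCompactSupport u → tsupport u ⊆ Ω → IsUpperGradient u g →
      ∫⁻ x, ‖u x‖ₑ ^ p * infEDist x Ωᶜ ^ (-p) ∂μ ≤ C * ∫⁻ x, g x ^ p ∂μ := by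
  have hp0 : 0 < p := by linarith
  -- Here `2σ` uses at most half of the gap `t - p`, leaving the other half for `η`. With `δ = 0`
  -- and `q = p` the averaging hypothesis is trivial.
  obtain ⟨C, c, hc, hmain⟩ := exists_weighted_hardy_of_isThin (q := p) (δ := 0)
    (σ := min (p / 2) ((t - p) / 4)) hμ hX hE hp0 le_rfl
    (lt_min (by linarith) (by linarith)) (by linarith [min_le_left (p / 2) ((t - p) / 4)])
    (by linarith) hthin hP ⟨1, fun G _ x R _ => by simp [div_self hp0.ne']⟩
  -- `2^p` comes from the factor in the product rule, `2^(p-1)` from convexity of the `p`-th power.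
  set B : ℝ≥0∞ := 2 ^ p * 2 ^ (p - 1) with hB
  have hBt : B ≠ ∞ := ENNReal.mul_ne_top (two_rpow_ne_top _) (two_rpow_ne_top _)
  have hCBt : C * B ≠ ∞ := ENNReal.mul_ne_top ENNReal.coe_ne_top hBt
  set N : ℝ := (C * B).toReal with hN
  have hN0 : 0 ≤ N := ENNReal.toReal_nonneg
  obtain ⟨η, hη, hηt, hη1, hsmall⟩ := exists_small_exponent (ε := 1 / (2 * (N + 1)))
    (η₀ := (t - p) / 2) hp hc (by positivity) (by linarith)
  set S : ℝ := c ^ η / (1 - 2 ^ (-η)) with hS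
  set γ : ℝ := η / p with hγ
  have hγ0 : 0 < γ := by positivity
  have hγ1 : γ ≤ 1 := (div_le_one hp0).2 (by linarith)
  have hγp : γ * p = η := div_mul_cancel₀ _ hp0.ne'
  have habs : C * B * ENNReal.ofReal S * ENNReal.ofReal γ ^ p ≤ 1 / 2 := by
    rw [ENNReal.ofReal_rpow_of_pos hγ0, mul_assoc, ← ENNReal.ofReal_mul' (by positivity),
      ← ENNReal.ofReal_toReal hCBt, ← hN, ← ENNReal.ofReal_mul hN0]
    calc ENNReal.ofReal (N * (S * γ ^ p)) ≤ ENNReal.ofReal (1 / 2) := by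
          refine ENNReal.ofReal_le_ofReal ?_
          calc N * (S * γ ^ p) ≤ N * (1 / (2 * (N + 1))) := by gcongr
            _ ≤ 1 / 2 := by
              rw [mul_one_div, div_le_div_iff₀ (by positivity) two_pos]
              linarith
      _ = 1 / 2 := by
          rw [ENNReal.ofReal_div_of_pos two_pos]; simp
  have hTt : 2 * (C * B * ENNReal.ofReal S) ≠ ∞ :=
    ENNReal.mul_ne_top ENNReal.ofNat_ne_top (ENNReal.mul_ne_top hCBt ENNReal.ofReal_ne_top)
  refine ⟨(2 * (C * B * ENNReal.ofReal S)).toNNReal, fun u g ⟨K, hK⟩ hu hsub hg => ?_⟩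
  rw [ENNReal.coe_toNNReal hTt]
  obtain ⟨θ, hθ, hsupp⟩ := exists_pos_le_infDist_of_tsupport_subset hΩ hE hu hsub
  -- Finiteness of `I`, without which `I / 2` could not be subtracted from both sides.
  have hIt := lintegral_rpow_mul_infEDist_ne_top hμ hp0 hK.continuous hu hE hθ hsupp
  set D : X → ℝ≥0∞ := fun x => infEDist x Ωᶜ with hD
  have hDm : Measurable D := measurable_infEDist
  have hDt : ∀ x, D x ≠ ∞ := fun x => infEDist_ne_top hE
  have hD0 : ∀ᵐ x ∂μ, D x ≠ 0 := hthin.ae_infEDist_ne_zero hμ (by linarith)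
  set I := ∫⁻ x, ‖u x‖ₑ ^ p * D x ^ (-p) ∂μ with hI
  set J := ∫⁻ x, g x ^ p ∂μ with hJ
  have hG := hg.mul_infDist_rpow hE hK hθ hsupp hγ0.le hγ1
  have hv := hmain η hη (by linarith [min_le_right (p / 2) ((t - p) / 4)]) _ _
    (hK.continuous.mul ((continuous_infDist_pt Ωᶜ).rpow_const fun _ => Or.inr hγ0.le))
    hu.mul_right hG
  have hleft : ∫⁻ x, ‖u x * infDist x Ωᶜ ^ γ‖ₑ ^ p * D x ^ (0 - η - p) ∂μ = I := by
    refine lintegral_congr_ae ?_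
    filter_upwards [hD0] with x hx
    have e : ‖infDist x Ωᶜ ^ γ‖ₑ = D x ^ γ := by
      rw [Real.enorm_eq_ofReal (Real.rpow_nonneg infDist_nonneg _),
        ← ENNReal.ofReal_rpow_of_nonneg infDist_nonneg hγ0.le, infDist,
        ENNReal.ofReal_toReal (hDt x)]
    rw [enorm_mul, e, ENNReal.mul_rpow_of_nonneg _ _ hp0.le, ← ENNReal.rpow_mul, hγp, mul_assoc,
      ← ENNReal.rpow_add _ _ hx (hDt x)]
    congr 2
    ring
  have hright : ∫⁻ x, (2 * (g x * D x ^ γ + ENNReal.ofReal γ * ‖u x‖ₑ * D x ^ (γ - 1))) ^ p *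
      D x ^ (0 - η) ∂μ ≤ B * (J + ENNReal.ofReal γ ^ p * I) := by
    calc _ ≤ ∫⁻ x, B * (g x ^ p + ENNReal.ofReal γ ^ p * (‖u x‖ₑ ^ p * D x ^ (-p))) ∂μ := by
          refine lintegral_mono_ae ?_
          filter_upwards [hD0] with x hx
          have e1 : D x ^ η * D x ^ (0 - η) = 1 := by
            rw [← ENNReal.rpow_add _ _ hx (hDt x)]; simp
          have e2 : D x ^ ((γ - 1) * p) * D x ^ (0 - η) = D x ^ (-p) := by
            rw [← ENNReal.rpow_add _ _ hx (hDt x), sub_mul, hγp]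
            congr 1
            ring
          rw [ENNReal.mul_rpow_of_nonneg _ _ hp0.le]
          calc _ ≤ 2 ^ p * (2 ^ (p - 1) * ((g x * D x ^ γ) ^ p +
                (ENNReal.ofReal γ * ‖u x‖ₑ * D x ^ (γ - 1)) ^ p)) * D x ^ (0 - η) := by
                gcongr
                exact ENNReal.rpow_add_le_mul_rpow_add_rpow _ _ hp.le
            _ = B * (g x ^ p * (D x ^ η * D x ^ (0 - η)) + ENNReal.ofReal γ ^ p *
                (‖u x‖ₑ ^ p * (D x ^ ((γ - 1) * p) * D x ^ (0 - η)))) := by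
                rw [ENNReal.mul_rpow_of_nonneg _ _ hp0.le, ENNReal.mul_rpow_of_nonneg _ _ hp0.le,
                  ENNReal.mul_rpow_of_nonneg _ _ hp0.le, ← ENNReal.rpow_mul, ← ENNReal.rpow_mul,
                  hγp, hB]
                ring
            _ = _ := by rw [e1, e2, mul_one]
      _ = _ := by
          rw [lintegral_const_mul' _ _ hBt, lintegral_add_left (hg.measurable.pow_const p),
            lintegral_const_mul' _ _ (ENNReal.rpow_ne_top_of_nonneg hp0.le ENNReal.ofReal_ne_top)]
  have hfinal : I ≤ C * B * ENNReal.ofReal S * J + I / 2 := by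
    calc I ≤ C * ENNReal.ofReal S * (B * (J + ENNReal.ofReal γ ^ p * I)) := by
          rw [← hleft]
          rw [← hleft] at hright
          exact hv.trans (by gcongr)
      _ = C * B * ENNReal.ofReal S * J + C * B * ENNReal.ofReal S * ENNReal.ofReal γ ^ p * I := by
          ring
      _ ≤ C * B * ENNReal.ofReal S * J + 1 / 2 * I := by gcongr
      _ = _ := by rw [one_div, ← ENNReal.div_eq_inv_mul]
  have hhalf : I / 2 ≠ ∞ := (ENNReal.div_lt_top hIt two_ne_zero).ne
  have h2 : I / 2 ≤ C * B * ENNReal.ofReal S * J := by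
    nth_rewrite 1 [← ENNReal.add_halves I] at hfinal
    exact (ENNReal.add_le_add_iff_right hhalf).1 hfinal
  calc I = 2 * (I / 2) := (ENNReal.mul_div_cancel two_ne_zero ENNReal.ofNat_ne_top).symm
    _ ≤ 2 * (C * B * ENNReal.ofReal S * J) := by gcongr
    _ = _ := by ring

end Unweighted

/-! ### Choice of parameters. -/

section Conclusion

variable {X : Type*} [MetricSpace X] [MeasurableSpace X] {μ : Measure X}

theorem exists_lt_of_lt_lowerAssouadCodim {E : Set X} {s : ℝ}
    (hs : 0 ≤ s) (h : ENNReal.ofReal s < lowerAssouadCodim μ E) :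
    ∃ t C : ℝ, s < t ∧ ∀ x ∈ E, ∀ r R : ℝ, 0 < r → r < R →
      μ (thickening r E ∩ closedBall x R) / μ (closedBall x R)
        ≤ ENNReal.ofReal (C * (r / R) ^ t) := by
  obtain ⟨t, ht⟩ := lt_iSup_iff.1 h
  obtain ⟨⟨C, -, hC⟩, ht⟩ := lt_iSup_iff.1 ht
  refine ⟨t, C, ?_, hC⟩
  rw [← ENNReal.ofReal_coe_nnreal] at ht
  exact (ENNReal.ofReal_lt_ofReal_iff_of_nonneg hs).1 ht

theorem admitsHardy_univ {p β : ℝ} (hβ : β < p) : AdmitsHardy μ univ p β := by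
  refine ⟨1, one_pos, fun u g _ _ _ _ => ?_⟩
  have : ∀ x : X, ‖u x‖ₑ ^ p * infEDist x univᶜ ^ (β - p) = 0 := fun x => by
    simp [ENNReal.top_rpow_of_neg (sub_neg.2 hβ)]
  simp_rw [this, lintegral_zero]
  exact bot_le

/-- The complement of `Ω` is null, so integrals over `Ω` are integrals over `X`. -/
theorem admitsHardy_of_ae [BorelSpace X] {Ω : Set X} {p β : ℝ}
    (hae : ∀ᵐ x ∂μ, infEDist x Ωᶜ ≠ 0) (h : ∃ C : ℝ≥0, ∀ (u : X → ℝ) (g : X → ℝ≥0∞),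
      (∃ K : ℝ≥0, LipschitzWith K u) → HasCompactSupport u → tsupport u ⊆ Ω →
      IsUpperGradient u g → ∫⁻ x, ‖u x‖ₑ ^ p * infEDist x Ωᶜ ^ (β - p) ∂μ
        ≤ C * ∫⁻ x, g x ^ p * infEDist x Ωᶜ ^ β ∂μ) :
    AdmitsHardy μ Ω p β := by
  obtain ⟨C, hC⟩ := h
  have hres : μ.restrict Ω = μ := by
    refine Measure.restrict_eq_self_of_ae_mem ?_
    filter_upwards [hae] with x hx
    by_contra hxΩ
    exact hx (infEDist_zero_of_mem hxΩ)
  refine ⟨C + 1, by positivity, fun u g hu hcs hsub hg => ?_⟩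
  rw [hres]
  refine (hC u g hu hcs hsub hg).trans ?_
  gcongr
  exact le_self_add

end Conclusion
end HardyAssouad

open HardyAssouad in
theorem theorem1p1 {X : Type*} [MetricSpace X] [CompleteSpace X] [MeasurableSpace X]
    [BorelSpace X] (μ : Measure X) (hμ : HardyAssouad.IsDoubling μ)
    (hX : ¬ Bornology.IsBounded (Set.univ : Set X))
    (p β : ℝ) (hp : 1 ≤ p) (hβ : β < p - 1)
    (hP_nonpos : β ≤ 0 → HardyAssouad.SupportsPoincare μ p)
    (hP_pos : 0 < β → HardyAssouad.SupportsPoincare μ (p - β))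
    (Ω : Set X) (hΩ : IsOpen Ω)
    (hcodim : ENNReal.ofReal (p - β) < HardyAssouad.lowerAssouadCodim μ Ωᶜ) :
    HardyAssouad.AdmitsHardy μ Ω p β := by
  rcases Ωᶜ.eq_empty_or_nonempty with hE | hE
  · rw [compl_empty_iff.1 hE]
    exact admitsHardy_univ (by linarith)
  have hp0 : 0 < p := by linarith
  have hpβ : 0 < p - β := by linarith
  obtain ⟨t, C₀, hpt, hC₀⟩ := exists_lt_of_lt_lowerAssouadCodim hpβ.le hcodim
  have ht : 0 < t := hpβ.trans hpt
  obtain ⟨A, hthin⟩ := exists_isThin hμ ht.le hC₀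
  refine admitsHardy_of_ae (hthin.ae_infEDist_ne_zero hμ ht) ?_
  rcases lt_trichotomy β 0 with hβ0 | rfl | hβ0
  · obtain ⟨C, c, -, h⟩ := exists_weighted_hardy_of_isThin (q := p) (δ := 0)
      (σ := min (p / 2) ((t - (p - β)) / 2)) hμ hX hE hp0 le_rfl
      (lt_min (by linarith) (by linarith)) (by linarith [min_le_left (p / 2) ((t - (p - β)) / 2)])
      ht hthin (hP_nonpos hβ0.le) ⟨1, fun G _ x R _ => by simp [div_self hp0.ne']⟩
    refine ⟨C * (c ^ (-β) / (1 - 2 ^ (- -β))).toNNReal, fun u g ⟨K, hK⟩ hu _ hg => ?_⟩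
    have := h (-β) (by linarith) (by linarith [min_le_right (p / 2) ((t - (p - β)) / 2)]) u g
      hK.continuous hu hg
    rw [zero_sub, neg_neg β] at this
    rw [neg_neg β]
    exact_mod_cast this
  · obtain ⟨C, h⟩ := exists_hardy_of_isThin hμ hX hΩ hE (by linarith) (by linarith) hthin
      (hP_nonpos le_rfl)
    refine ⟨C, fun u g hK hu hsub hg => ?_⟩
    simpa using h u g hK hu hsub hg
  -- With `q = p - β`, Hölder requires `δ (p - β) / β < t`. At `δ = β` this reads `p - β < t`, so
  -- some `δ` above `β` is still admissible, and `η = δ - β`.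
  · have hlt : β < min p (t * β / (p - β)) := by
      refine lt_min (by linarith) ?_
      rw [lt_div_iff₀ hpβ, mul_comm]
      gcongr
    obtain ⟨δ, hβδ, hδ⟩ := exists_between hlt
    have hδp : δ < p := hδ.trans_le (min_le_left _ _)
    have hδt : δ * (p - β) / (p - (p - β)) < t := by
      have h := hδ.trans_le (min_le_right _ _)
      rw [lt_div_iff₀ hpβ] at h
      rwa [sub_sub_cancel, div_lt_iff₀ hβ0]
    have hδ0 : 0 ≤ δ := by linarith
    obtain ⟨C, c, -, h⟩ := exists_weighted_hardy_of_isThin (q := p - β) (δ := δ)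
      (σ := min ((p - δ) / 2) ((t - (p - β)) / 2)) hμ hX hE hp0 hδ0
      (lt_min (by linarith) (by linarith))
      (by linarith [min_le_left ((p - δ) / 2) ((t - (p - β)) / 2)])
      ht hthin (hP_pos hβ0) (hthin.exists_rpow_setLAverage_le hE hμ ht hpβ (by linarith) hδ0 hδt)
    refine ⟨C * (c ^ (δ - β) / (1 - 2 ^ (-(δ - β)))).toNNReal, fun u g ⟨K, hK⟩ hu _ hg => ?_⟩
    have := h (δ - β) (by linarith)
      (by linarith [min_le_right ((p - δ) / 2) ((t - (p - β)) / 2)]) u g hK.continuous hu hg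
    rw [sub_sub_cancel] at this
    exact_mod_cast this
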